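/- Let $P\ge 1$ be an integer, $(\Omega,\mathcal F,\mathbb P)$ a probability space, $(a_k)_{k\ge1}$ a $P$-periodic sequence of real numbers, and put $A_s^r=\prod_{j=s}^r a_j$ for $1\le s\le r$, $A_s^{s-1}=1$, and $\phi=A_1^P=\prod_{r=1}^P a_r$; assume $|\phi|>1$. Let $(u_k)_{k\ge1}$ be real centered square integrable random variables that are periodically distributed, i.e. $\mathcal L[u_{P+s},\dots,u_{P+r}]=\mathcal L[u_s,\dots,u_r]$ for all $1\le s\le r$; let $X_0$ be a square integrable random variable and $X_k=a_kX_{k-1}+u_k$ for $k\ge1$. For $1\le r\le P$ and $n\ge 1$ let $$\hat a_r=\hat a_{r,n}=\frac{\sum_{j=0}^{n-1}X_{jP+r-1}X_{jP+r}}{\sum_{j=0}^{n-1}X_{jP+r-1}^2},\qquad \tilde\phi=\tilde\phi_n=\prod_{r=1}^P\hat a_r .$$ Let $Z_n=\sum_{l=0}^{n}\phi^{-l-1}\sum_{s=1}^{P}A_{s+1}^{P}u_{lP+s}$. Then $Z_n$ converges almost surely; let $\zeta$ be its limit. (i) Almost surely on the event $\{X_0+\zeta\neq0\}$, $\tilde\phi_n\to\phi$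 as $n\to\infty$. In particular $\tilde\phi_n\to\phi$ almost surely if $\mathbb P[X_0+\zeta=0]=0$. (ii) Assume that $\mathbb P[X_0+\zeta=0]=0$ and that the strong mixing condition (M) holds: $\alpha(n)\to0$ as $n\to\infty$, where $\alpha(n)=\sup|\mathbb P[A\cap B]-\mathbb P[A]\mathbb P[B]|$, the supremum being over all integers $k\ge0$, all $A\in\sigma(X_0,u_j:1\le j\le k)$ and all $B\in\sigma(u_j:j\ge \max(k+n,1))$. Let $(u_k^*)_{k\ge0}$ be random variables on $\Omega$ such that the sequence $(u_k^*)$ is independent of $(X_0,(u_k)_{k\ge1})$ and $\mathcal L[u_0^*,\dots,u_{nP-1}^*]=\mathcal L[u_{nP},\dots,u_1]$ for every integer $n>1$ (such a sequence exists, if necessary after enlarging the probability space). Then for $r=1,\dots,P$ the series $\zeta_r^*=\sum_{j=1}^{\infty}\phi^{-j}u_{jP-r}^*$ converges absolutely almost surely, the vector $(\zeta_1^*,\dots,\zeta_P^*)$ is independent of $(X_0,\zeta)$, and, as $n\to\infty$, $$\phi^n\big(\tilde\phi_n-\phi\big)\ \longrightarrow\ \frac{\phi^2-1}{X_0+\zeta}\sum_{r=1}^{P}A_{r+1}^{P}\,\zeta_r^*\qquad\text{in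 distribution.}$$ -/

import Mathlib

open MeasureTheory ProbabilityTheory Filter Topology

noncomputable section

/-- `A_s^r = ∏_{j=s}^r a_j` for `s ≤ r`, with `A_s^{s-1} = 1` and `A_s^r = 0` otherwise. -/
def coeffProd (a : ℕ → ℝ) (s r : ℕ) : ℝ :=
  if s ≤ r + 1 then ∏ j ∈ Finset.Icc s r, a j else 0

/-- `φ = A_1^P`, the product of the coefficients over one period. -/
def parPhi (a : ℕ → ℝ) (P : ℕ) : ℝ := coeffProd a 1 P

/-- `U_n^{(r)} = ∑_{s=1}^r A_{s+1}^r u_{nP+s}`. -/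
def parU {Ω : Type*} (a : ℕ → ℝ) (u : ℕ → Ω → ℝ) (P n r : ℕ) (ω : Ω) : ℝ :=
  ∑ s ∈ Finset.Icc 1 r, coeffProd a (s + 1) r * u (n * P + s) ω

/-- `Z_n = ∑_{l=0}^n φ^{-l-1} U_l^{(P)}`. -/
def parZ {Ω : Type*} (a : ℕ → ℝ) (u : ℕ → Ω → ℝ) (P n : ℕ) (ω : Ω) : ℝ :=
  ∑ l ∈ Finset.range (n + 1), (parPhi a P ^ (l + 1))⁻¹ * parU a u P l P ω

/-- `ζ = lim_n Z_n`, the pointwise limit (arbitrary where the limit does not exist). -/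
def parZeta {Ω : Type*} (a : ℕ → ℝ) (u : ℕ → Ω → ℝ) (P : ℕ) (ω : Ω) : ℝ :=
  limUnder atTop (fun n : ℕ => parZ a u P n ω)

/-- The term `φ^{-j} u*_{jP-r}`, to be used for `j ≥ 1` and `1 ≤ r ≤ P`, where `r ≤ j P`. -/
def starTerm {Ω : Type*} (a : ℕ → ℝ) (ustar : ℕ → Ω → ℝ) (P r j : ℕ) (ω : Ω) : ℝ :=
  (parPhi a P ^ j)⁻¹ * ustar (j * P - r) ω

/-- `ζ_r^* = ∑_{j=1}^∞ φ^{-j} u*_{jP-r}`. -/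
def zetaStar {Ω : Type*} (a : ℕ → ℝ) (ustar : ℕ → Ω → ℝ) (P r : ℕ) (ω : Ω) : ℝ :=
  ∑' j : ℕ, starTerm a ustar P r (j + 1) ω

/-- The least squares estimator of `a_r` (for `1 ≤ r ≤ P`) from `X_0, …, X_{nP}`. -/
def lse {Ω : Type*} (X : ℕ → Ω → ℝ) (P r n : ℕ) (ω : Ω) : ℝ :=
  (∑ j ∈ Finset.range n, X (j * P + r - 1) ω * X (j * P + r) ω) /
    ∑ j ∈ Finset.range n, X (j * P + r - 1) ω ^ 2

/-- The product estimator `∏_{r=1}^P â_r` of `φ`. -/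
def phiTilde {Ω : Type*} (X : ℕ → Ω → ℝ) (P n : ℕ) (ω : Ω) : ℝ :=
  ∏ r ∈ Finset.Icc 1 P, lse X P r n ω

/-- The σ-field generated by `Y` (the initial value) and `u_j`, `1 ≤ j ≤ k`. -/
@[reducible] def pastField {Ω : Type*} (Y : Ω → ℝ) (u : ℕ → Ω → ℝ) (k : ℕ) : MeasurableSpace Ω :=
  MeasurableSpace.comap Y inferInstance ⊔
    ⨆ (j : ℕ) (_ : 1 ≤ j ∧ j ≤ k), MeasurableSpace.comap (u j) inferInstance

/-- The σ-field generated by `u_j`, `j ≥ m`, `j ≥ 1`. -/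
@[reducible] def futureField {Ω : Type*} (u : ℕ → Ω → ℝ) (m : ℕ) : MeasurableSpace Ω :=
  ⨆ (j : ℕ) (_ : 1 ≤ j ∧ m ≤ j), MeasurableSpace.comap (u j) inferInstance

/-- The strong mixing coefficient `α(n)`. For a probability measure the supremum is that of a
nonempty set of reals in `[0, 1]`. -/
def alphaMix {Ω : Type*} [MeasurableSpace Ω] (μ : Measure Ω) (Y : Ω → ℝ) (u : ℕ → Ω → ℝ)
    (n : ℕ) : ℝ :=
  sSup {x : ℝ | ∃ (k : ℕ) (A B : Set Ω),
    MeasurableSet[pastField Y u k] A ∧ MeasurableSet[futureField u (k + n)] B ∧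
      x = |μ.real (A ∩ B) - μ.real A * μ.real B|}

/-- The strong mixing condition (M). -/
def StrongMixing {Ω : Type*} [MeasurableSpace Ω] (μ : Measure Ω) (Y : Ω → ℝ)
    (u : ℕ → Ω → ℝ) : Prop :=
  Tendsto (alphaMix μ Y u) atTop (𝓝 0)

end

/-! Everything rests on the exponential growth of `X`. Iterating the recursion over whole periods
gives `φ^{-n} X_{nP+r} → A_1^r (X_0 + ζ)`. Since `E|u_k|` is bounded, `∑ |φ|^{-l/2} |u_{lP+s}|` is
almost surely finite (`ae_slowGrowth`), and on that event the convergence has error `o(|φ|^{-n/2})`.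
From there consistency is pathwise. The error of `â_r` is noise over energy; by a Toeplitz lemma for
geometric weights (`tendsto_geomConv`) the energy divided by `φ^{2n}` has a nonzero limit when `X_0
+ ζ ≠ 0`, while the noise divided by `φ^{2n}` vanishes.

For the limit law, the noise divided by `φ^n` is compared with `A_1^{r-1} (X_0 + ζ) ∑_{j<n}
φ^{-(n-j)} u_{jP+r}`, and a telescoping product turns the errors of the factors into `φ^n (φ̃ - φ) ≈
(φ² - 1) / (X_0 + ζ) · B_n`, with `B_n` equal to `blockSum`. The remainder is small only relative to
weighted sums that need not converge but are bounded in `L¹`, so it vanishes in probability.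

Reversing time, `B_n` has the law of a partial sum of `∑_r A_{r+1}^P ζ_r^*`, hence converges in
distribution. Up to a negligible term `B_n` involves only innovations after time `⌊n/2⌋ P`, while
`X_0 + ζ` is approximated by `φ^{-⌊n/4⌋} X_{⌊n/4⌋P}`. Mixing across the gap factorizes the joint
characteristic function asymptotically, which gives joint convergence to an independent pair;
multiplication and Slutsky's lemma conclude. -/

/-! ### Convolution with a geometric sequence -/

/-- The convolution `∑_{j<n} q^{-(n-j)} x_j`. -/
noncomputable def geomConv (q : ℝ) (x : ℕ → ℝ) (n : ℕ) : ℝ :=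
  ∑ j ∈ Finset.range n, (q ^ (n - j))⁻¹ * x j

/-- Indexing by the lag `k` makes the weights independent of `n`, the form in which dominated
convergence for series applies. -/
theorem geomConv_eq_tsum (q : ℝ) (x : ℕ → ℝ) (n : ℕ) :
    geomConv q x n = ∑' k, if k < n then (q ^ (k + 1))⁻¹ * x (n - 1 - k) else 0 := by
  rw [tsum_eq_sum (s := Finset.range n) (fun k hk => by simp_all), geomConv,
    ← Finset.sum_range_reflect]
  refine Finset.sum_congr rfl fun k hk => ?_
  have hk' := Finset.mem_range.1 hk
  rw [if_pos hk']
  congr 3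
  omega

theorem hasSum_inv_pow_succ {q : ℝ} (hq : 1 < |q|) :
    HasSum (fun k : ℕ => (q ^ (k + 1))⁻¹) (q - 1)⁻¹ := by
  have hq0 : q ≠ 0 := by rintro rfl; simp at hq; linarith
  have hq1 : q - 1 ≠ 0 := fun h => by
    have : q = 1 := by linarith
    simp [this] at hq
  have h : |q⁻¹| < 1 := by rw [abs_inv]; exact inv_lt_one_of_one_lt₀ hq
  have h2 := (hasSum_geometric_of_abs_lt_one h).mul_left q⁻¹
  have e : q⁻¹ * (1 - q⁻¹)⁻¹ = (q - 1)⁻¹ := by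
    rw [← mul_inv]; congr 1; field_simp
  rw [e] at h2
  exact h2.congr_fun fun k => by rw [pow_succ, mul_inv, inv_pow, mul_comm]

/-- Toeplitz lemma for geometric weights. -/
theorem tendsto_geomConv {q : ℝ} (hq : 1 < |q|) {x : ℕ → ℝ} {L : ℝ}
    (hx : Tendsto x atTop (𝓝 L)) : Tendsto (geomConv q x) atTop (𝓝 (L / (q - 1))) := by
  obtain ⟨C, hC⟩ : ∃ C, ∀ n, |x n| ≤ C := by
    obtain ⟨C, hC⟩ := (Metric.isBounded_range_of_tendsto x hx).exists_norm_le
    exact ⟨C, fun n => hC _ ⟨n, rfl⟩⟩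
  have e : L / (q - 1) = ∑' k : ℕ, (q ^ (k + 1))⁻¹ * L := by
    rw [((hasSum_inv_pow_succ hq).mul_right L).tsum_eq, div_eq_inv_mul]
  rw [e, show geomConv q x = fun n => ∑' k, if k < n then (q ^ (k + 1))⁻¹ * x (n - 1 - k) else 0
    from funext (geomConv_eq_tsum q x)]
  have hs : Summable fun k : ℕ => (|q| ^ (k + 1))⁻¹ * C :=
    ((hasSum_inv_pow_succ (q := |q|) (by simpa using hq)).summable).mul_right C
  -- A bound `C` for the convergent sequence gives the summable majorant `C |q|^{-(k+1)}`, uniform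
  -- in `n`.
  refine tendsto_tsum_of_dominated_convergence hs (fun k => ?_)
    (Eventually.of_forall fun n k => ?_)
  · have h1 : Tendsto (fun n => (q ^ (k + 1))⁻¹ * x (n - 1 - k)) atTop
        (𝓝 ((q ^ (k + 1))⁻¹ * L)) := by
      refine (hx.comp ?_).const_mul _
      exact (tendsto_sub_atTop_nat k).comp (tendsto_sub_atTop_nat 1)
    refine h1.congr' ?_
    filter_upwards [eventually_gt_atTop k] with n hn
    rw [if_pos hn]
  · have hC0 : 0 ≤ C := (abs_nonneg _).trans (hC 0)
    split_ifs with h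
    · rw [Real.norm_eq_abs, abs_mul, abs_inv, abs_pow]
      gcongr
      exact hC _
    · rw [norm_zero]; positivity

theorem geomConv_add (q : ℝ) (x y : ℕ → ℝ) (n : ℕ) :
    geomConv q (fun j => x j + y j) n = geomConv q x n + geomConv q y n := by
  simp [geomConv, mul_add, Finset.sum_add_distrib]

theorem geomConv_const_mul (q c : ℝ) (x : ℕ → ℝ) (n : ℕ) :
    geomConv q (fun j => c * x j) n = c * geomConv q x n := by
  rw [geomConv, geomConv, Finset.mul_sum]
  exact Finset.sum_congr rfl fun _ _ => by ring

theorem geomConv_sum {ι : Type*} (s : Finset ι) (q : ℝ) (x : ι → ℕ → ℝ) (n : ℕ) :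
    geomConv q (fun j => ∑ i ∈ s, x i j) n = ∑ i ∈ s, geomConv q (x i) n := by
  simp only [geomConv, Finset.mul_sum]
  exact Finset.sum_comm

/-- This brings the Toeplitz lemma to bear on the numerators and denominators of the estimators once
they are divided by `φ^n` or `φ^{2n}`. -/
theorem inv_pow_mul_sum_eq_geomConv (q : ℝ) (x : ℕ → ℝ) (n : ℕ) :
    (q ^ n)⁻¹ * ∑ j ∈ Finset.range n, x j = geomConv q (fun j => (q ^ j)⁻¹ * x j) n := by
  rw [geomConv, Finset.mul_sum]
  refine Finset.sum_congr rfl fun j hj => ?_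
  have hj' := (Finset.mem_range.1 hj).le
  rw [← mul_assoc, ← mul_inv, ← pow_add, Nat.sub_add_cancel hj']

/-! ### The periodic autoregressive recursion -/

theorem coeffProd_self_succ (a : ℕ → ℝ) (r : ℕ) : coeffProd a (r + 1) r = 1 := by
  simp [coeffProd]

theorem coeffProd_succ (a : ℕ → ℝ) {s r : ℕ} (h : s ≤ r + 1) :
    coeffProd a s (r + 1) = coeffProd a s r * a (r + 1) := by
  rw [coeffProd, coeffProd, if_pos (by omega), if_pos h, Finset.prod_Icc_succ_top h]

theorem coeffProd_mul (a : ℕ → ℝ) {s r t : ℕ} (h : s ≤ r + 1) (ht : r ≤ t) :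
    coeffProd a s r * coeffProd a (r + 1) t = coeffProd a s t := by
  induction t, ht using Nat.le_induction with
  | base => rw [coeffProd_self_succ, mul_one]
  | succ t ht ih => rw [coeffProd_succ a (by omega), coeffProd_succ a (by omega), ← ih, mul_assoc]

theorem parPhi_eq_mul (a : ℕ → ℝ) {P r : ℕ} (hr : r ∈ Finset.Icc 1 P) :
    coeffProd a 1 (r - 1) * a r * coeffProd a (r + 1) P = parPhi a P := by
  obtain ⟨h1, h2⟩ := Finset.mem_Icc.1 hr
  obtain ⟨k, rfl⟩ : ∃ k, r = k + 1 := ⟨r - 1, by omega⟩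
  rw [Nat.add_sub_cancel, ← coeffProd_succ a (by omega), coeffProd_mul a (by omega) h2, parPhi]

theorem periodic_mul_add {a : ℕ → ℝ} {P : ℕ} (ha : ∀ k, 1 ≤ k → a (k + P) = a k) (n : ℕ) {k : ℕ}
    (hk : 1 ≤ k) : a (n * P + k) = a k := by
  induction n with
  | zero => simp
  | succ n ih => rw [show (n + 1) * P + k = (n * P + k) + P by ring, ha _ (by omega), ih]

section Path

variable {Ω : Type*} {a : ℕ → ℝ} {u X : ℕ → Ω → ℝ} {P : ℕ}

theorem parU_succ (n r : ℕ) (ω : Ω) :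
    parU a u P n (r + 1) ω = a (r + 1) * parU a u P n r ω + u (n * P + (r + 1)) ω := by
  rw [parU, Finset.sum_Icc_succ_top (by omega), coeffProd_self_succ, one_mul, parU, Finset.mul_sum]
  congr 1
  refine Finset.sum_congr rfl fun s hs => ?_
  have := (Finset.mem_Icc.1 hs).2
  rw [coeffProd_succ a (by omega)]
  ring

theorem apply_mul_add (ha : ∀ k, 1 ≤ k → a (k + P) = a k)
    (hX : ∀ (k : ℕ) (ω : Ω), X (k + 1) ω = a (k + 1) * X k ω + u (k + 1) ω) (n r : ℕ) (ω : Ω) :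
    X (n * P + r) ω = coeffProd a 1 r * X (n * P) ω + parU a u P n r ω := by
  induction r with
  | zero => simp [parU, coeffProd_self_succ a 0]
  | succ r ih =>
    rw [← add_assoc, hX, ih, parU_succ, coeffProd_succ a (by omega), add_assoc,
      periodic_mul_add ha n (by omega)]
    ring

theorem apply_mul_period (ha : ∀ k, 1 ≤ k → a (k + P) = a k) (hphi : parPhi a P ≠ 0)
    (hX : ∀ (k : ℕ) (ω : Ω), X (k + 1) ω = a (k + 1) * X k ω + u (k + 1) ω) (n : ℕ) (ω : Ω) :
    (parPhi a P ^ n)⁻¹ * X (n * P) ω =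
      X 0 ω + ∑ l ∈ Finset.range n, (parPhi a P ^ (l + 1))⁻¹ * parU a u P l P ω := by
  induction n with
  | zero => simp
  | succ n ih =>
    rw [Finset.sum_range_succ, ← add_assoc, ← ih, show (n + 1) * P = n * P + P by ring,
      apply_mul_add ha hX, ← parPhi, pow_succ]
    field_simp

/-! ### Pathwise convergence of the scaled process, with a rate -/

/-- The paths of the innovations grow at most like `|φ|^{l/2}`, in the sense of summability. -/
def SlowGrowth (a : ℕ → ℝ) (u : ℕ → Ω → ℝ) (P : ℕ) (ω : Ω) : Prop :=
  ∀ s ∈ Finset.Icc 1 P, Summable fun l : ℕ => (√|parPhi a P| ^ l)⁻¹ * |u (l * P + s) ω|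

variable {ω : Ω}

theorem SlowGrowth.summable_parU (h : SlowGrowth a u P ω) {r : ℕ} (hr : r ≤ P) :
    Summable fun l : ℕ => (√|parPhi a P| ^ l)⁻¹ * |parU a u P l r ω| := by
  have h1 : Summable fun l : ℕ => ∑ s ∈ Finset.Icc 1 r,
      |coeffProd a (s + 1) r| * ((√|parPhi a P| ^ l)⁻¹ * |u (l * P + s) ω|) :=
    summable_sum fun s hs => (h s (Finset.Icc_subset_Icc le_rfl hr hs)).mul_left _
  refine h1.of_nonneg_of_le (fun l => by positivity) fun l => ?_
  calc (√|parPhi a P| ^ l)⁻¹ * |parU a u P l r ω|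
      ≤ (√|parPhi a P| ^ l)⁻¹ *
          ∑ s ∈ Finset.Icc 1 r, |coeffProd a (s + 1) r * u (l * P + s) ω| := by
        gcongr; exact Finset.abs_sum_le_sum_abs _ _
    _ = _ := by
        rw [Finset.mul_sum]
        exact Finset.sum_congr rfl fun s _ => by rw [abs_mul]; ring

theorem sqrt_pow_mul_inv_pow (q : ℝ) (hq : q ≠ 0) (l : ℕ) :
    √|q| ^ l * (|q| ^ l)⁻¹ = (√|q| ^ l)⁻¹ := by
  have h : 0 < √|q| := Real.sqrt_pos.2 (abs_pos.2 hq)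
  nth_rewrite 2 [← Real.mul_self_sqrt (abs_nonneg q)]
  rw [mul_pow]
  field_simp

theorem one_lt_sqrt_abs {q : ℝ} (hq : 1 < |q|) : 1 < √|q| := by
  rw [← Real.sqrt_one]
  exact Real.sqrt_lt_sqrt zero_le_one hq

theorem SlowGrowth.summable_parZ (hphi : 1 < |parPhi a P|) (h : SlowGrowth a u P ω) :
    Summable fun l : ℕ => (parPhi a P ^ (l + 1))⁻¹ * parU a u P l P ω := by
  have hq0 : parPhi a P ≠ 0 := abs_pos.1 (by linarith)
  refine Summable.of_norm_bounded (h.summable_parU le_rfl) fun l => ?_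
  rw [Real.norm_eq_abs, abs_mul, abs_inv, abs_pow]
  gcongr
  calc √|parPhi a P| ^ l ≤ √|parPhi a P| ^ (2 * (l + 1)) :=
        pow_le_pow_right₀ (one_lt_sqrt_abs hphi).le (by omega)
    _ = |parPhi a P| ^ (l + 1) := by rw [pow_mul, Real.sq_sqrt (abs_nonneg _)]

theorem SlowGrowth.hasSum_parZeta (hphi : 1 < |parPhi a P|) (h : SlowGrowth a u P ω) :
    HasSum (fun l : ℕ => (parPhi a P ^ (l + 1))⁻¹ * parU a u P l P ω) (parZeta a u P ω) := by
  have hs := (h.summable_parZ hphi).hasSum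
  have : parZeta a u P ω = ∑' l : ℕ, (parPhi a P ^ (l + 1))⁻¹ * parU a u P l P ω :=
    Tendsto.limUnder_eq ((tendsto_add_atTop_iff_nat 1).2 hs.tendsto_sum_nat)
  rwa [this]

theorem SlowGrowth.tendsto_parZ (hphi : 1 < |parPhi a P|) (h : SlowGrowth a u P ω) :
    Tendsto (fun n => parZ a u P n ω) atTop (𝓝 (parZeta a u P ω)) :=
  (tendsto_add_atTop_iff_nat 1).2 (h.hasSum_parZeta hphi).tendsto_sum_nat

/-- The scaled process approaches its limit faster than `|φ|^{-n/2}`. -/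
theorem SlowGrowth.tendsto_sqrt_pow_mul_sub (ha : ∀ k, 1 ≤ k → a (k + P) = a k)
    (hphi : 1 < |parPhi a P|)
    (hX : ∀ (k : ℕ) (ω : Ω), X (k + 1) ω = a (k + 1) * X k ω + u (k + 1) ω)
    (h : SlowGrowth a u P ω) {r : ℕ} (hr : r ≤ P) :
    Tendsto (fun n => √|parPhi a P| ^ n * ((parPhi a P ^ n)⁻¹ * X (n * P + r) ω
      - coeffProd a 1 r * (X 0 ω + parZeta a u P ω))) atTop (𝓝 0) := by
  have hq0 : parPhi a P ≠ 0 := abs_pos.1 (by linarith)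
  have ht := one_lt_sqrt_abs hphi
  set q := parPhi a P with hqdef
  have hA : Tendsto (fun n => √|q| ^ n * ((q ^ n)⁻¹ * X (n * P) ω -
      (X 0 ω + parZeta a u P ω))) atTop (𝓝 0) := by
    have hsum := h.summable_parU le_rfl
    have htail := tendsto_sum_nat_add fun l : ℕ => (√|q| ^ l)⁻¹ * |parU a u P l P ω|
    refine squeeze_zero_norm (fun n => ?_) htail
    -- The scaled process at time `nP` is `X_0` plus a partial sum of the series for `ζ`, so the
    -- error is minus its tail.
    have e : (q ^ n)⁻¹ * X (n * P) ω - (X 0 ω + parZeta a u P ω) =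
        -∑' l : ℕ, (q ^ (l + n + 1))⁻¹ * parU a u P (l + n) P ω := by
      rw [apply_mul_period ha hq0 hX, ← (h.hasSum_parZeta hphi).tsum_eq,
        ← (h.summable_parZ hphi).sum_add_tsum_nat_add n]
      ring
    rw [e, norm_mul, norm_neg, Real.norm_eq_abs, abs_of_nonneg (by positivity)]
    -- Half of the decay of `q^{-(l+n+1)}` absorbs the factor `√|q|^n`; the other half leaves the
    -- weights of the slow growth condition.
    have hb : ∀ l : ℕ, √|q| ^ n * ‖(q ^ (l + n + 1))⁻¹ * parU a u P (l + n) P ω‖ ≤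
        (√|q| ^ (l + n))⁻¹ * |parU a u P (l + n) P ω| := fun l => by
      rw [norm_mul, norm_inv, norm_pow, Real.norm_eq_abs, Real.norm_eq_abs, ← mul_assoc]
      gcongr
      rw [← sqrt_pow_mul_inv_pow q hq0]
      refine mul_le_mul (pow_le_pow_right₀ ht.le (by omega)) ?_ (by positivity) (by positivity)
      exact inv_anti₀ (by positivity) (pow_le_pow_right₀ hphi.le (by omega))
    have hs1 : Summable fun l : ℕ => ‖(q ^ (l + n + 1))⁻¹ * parU a u P (l + n) P ω‖ :=
      ((summable_nat_add_iff n).2 (h.summable_parZ hphi)).norm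
    calc √|q| ^ n * ‖∑' l : ℕ, (q ^ (l + n + 1))⁻¹ * parU a u P (l + n) P ω‖
        ≤ √|q| ^ n * ∑' l : ℕ, ‖(q ^ (l + n + 1))⁻¹ * parU a u P (l + n) P ω‖ := by
          gcongr; exact norm_tsum_le_tsum_norm hs1
      _ = ∑' l : ℕ, √|q| ^ n * ‖(q ^ (l + n + 1))⁻¹ * parU a u P (l + n) P ω‖ :=
          (tsum_mul_left).symm
      _ ≤ _ := (hs1.mul_left _).tsum_le_tsum hb ((summable_nat_add_iff n).2 hsum)
  -- The innovations inside the current, incomplete period.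
  have hB : Tendsto (fun n => √|q| ^ n * ((q ^ n)⁻¹ * parU a u P n r ω)) atTop (𝓝 0) := by
    refine squeeze_zero_norm (fun n => ?_) (h.summable_parU hr).tendsto_atTop_zero
    rw [norm_mul, norm_mul, norm_inv, norm_pow, norm_pow, Real.norm_eq_abs, Real.norm_eq_abs,
      Real.norm_eq_abs, abs_of_nonneg (Real.sqrt_nonneg _), ← mul_assoc,
      sqrt_pow_mul_inv_pow q hq0]
  have := (hA.const_mul (coeffProd a 1 r)).add hB
  rw [mul_zero, add_zero] at this
  refine this.congr fun n => ?_
  rw [apply_mul_add ha hX n r]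
  ring

theorem SlowGrowth.tendsto_inv_pow_mul (ha : ∀ k, 1 ≤ k → a (k + P) = a k)
    (hphi : 1 < |parPhi a P|)
    (hX : ∀ (k : ℕ) (ω : Ω), X (k + 1) ω = a (k + 1) * X k ω + u (k + 1) ω)
    (h : SlowGrowth a u P ω) {r : ℕ} (hr : r ≤ P) :
    Tendsto (fun n => (parPhi a P ^ n)⁻¹ * X (n * P + r) ω) atTop
      (𝓝 (coeffProd a 1 r * (X 0 ω + parZeta a u P ω))) := by
  have ht := one_lt_sqrt_abs hphi
  rw [← tendsto_sub_nhds_zero_iff]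
  refine squeeze_zero_norm (fun n => ?_)
    (tendsto_zero_iff_norm_tendsto_zero.1 (h.tendsto_sqrt_pow_mul_sub ha hphi hX hr))
  rw [norm_mul, norm_pow, Real.norm_of_nonneg (Real.sqrt_nonneg _)]
  exact le_mul_of_one_le_left (norm_nonneg _) (one_le_pow₀ ht.le)

end Path

/-! ### Pathwise asymptotics of the least squares and product estimators -/

section LeastSquares

variable {Ω : Type*} {a : ℕ → ℝ} {u X : ℕ → Ω → ℝ} {P : ℕ} {ω : Ω}

/-- The numerator of the error of the least squares estimator. -/
noncomputable def lseNoise (u X : ℕ → Ω → ℝ) (P r n : ℕ) (ω : Ω) : ℝ :=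
  ∑ j ∈ Finset.range n, X (j * P + r - 1) ω * u (j * P + r) ω

/-- The denominator of the least squares estimator. -/
noncomputable def lseEnergy (X : ℕ → Ω → ℝ) (P r n : ℕ) (ω : Ω) : ℝ :=
  ∑ j ∈ Finset.range n, X (j * P + r - 1) ω ^ 2

/-- The geometrically weighted innovations `∑_{j<n} φ^{-(n-j)} u_{jP+r}` of one season. -/
noncomputable def seasonSum (a : ℕ → ℝ) (u : ℕ → Ω → ℝ) (P r n : ℕ) (ω : Ω) : ℝ :=
  geomConv (parPhi a P) (fun j => u (j * P + r) ω) n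

/-- The geometrically weighted innovations `∑_{j<n} φ^{-(n-j)} U_j` of all seasons. -/
noncomputable def blockSum (a : ℕ → ℝ) (u : ℕ → Ω → ℝ) (P n : ℕ) (ω : Ω) : ℝ :=
  geomConv (parPhi a P) (fun j => parU a u P j P ω) n

theorem blockSum_eq_sum (n : ℕ) : blockSum a u P n ω =
    ∑ r ∈ Finset.Icc 1 P, coeffProd a (r + 1) P * seasonSum a u P r n ω := by
  simp only [blockSum, parU, geomConv_sum, geomConv_const_mul, seasonSum]

theorem lse_sub (ha : ∀ k, 1 ≤ k → a (k + P) = a k)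
    (hX : ∀ (k : ℕ) (ω : Ω), X (k + 1) ω = a (k + 1) * X k ω + u (k + 1) ω) {r n : ℕ}
    (hr : 1 ≤ r) (hE : lseEnergy X P r n ω ≠ 0) :
    lse X P r n ω - a r = lseNoise u X P r n ω / lseEnergy X P r n ω := by
  have e : ∑ j ∈ Finset.range n, X (j * P + r - 1) ω * X (j * P + r) ω =
      a r * lseEnergy X P r n ω + lseNoise u X P r n ω := by
    rw [lseEnergy, lseNoise, Finset.mul_sum, ← Finset.sum_add_distrib]
    refine Finset.sum_congr rfl fun j _ => ?_
    obtain ⟨k, rfl⟩ : ∃ k, r = k + 1 := ⟨r - 1, by omega⟩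
    rw [← add_assoc, hX, Nat.add_sub_cancel, add_assoc, periodic_mul_add ha j hr]
    ring
  rw [lse, e, ← lseEnergy]
  field_simp
  ring

theorem SlowGrowth.tendsto_inv_sqrt_pow_mul (h : SlowGrowth a u P ω) {r : ℕ}
    (hr : r ∈ Finset.Icc 1 P) :
    Tendsto (fun n => (√|parPhi a P| ^ n)⁻¹ * u (n * P + r) ω) atTop (𝓝 0) := by
  refine squeeze_zero_norm (fun n => ?_) (h r hr).tendsto_atTop_zero
  rw [norm_mul, Real.norm_of_nonneg (by positivity), Real.norm_eq_abs]

theorem SlowGrowth.tendsto_inv_pow_mul_innovation (hphi : 1 < |parPhi a P|)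
    (h : SlowGrowth a u P ω) {r : ℕ} (hr : r ∈ Finset.Icc 1 P) :
    Tendsto (fun n => (parPhi a P ^ n)⁻¹ * u (n * P + r) ω) atTop (𝓝 0) := by
  refine squeeze_zero_norm (fun n => ?_) (h r hr).tendsto_atTop_zero
  have ht := one_lt_sqrt_abs hphi
  rw [norm_mul, norm_inv, norm_pow, Real.norm_eq_abs, Real.norm_eq_abs]
  gcongr
  nth_rewrite 2 [← Real.mul_self_sqrt (abs_nonneg (parPhi a P))]
  exact le_mul_of_one_le_left (by positivity) ht.le

variable (ha : ∀ k, 1 ≤ k → a (k + P) = a k) (hphi : 1 < |parPhi a P|)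
  (hX : ∀ (k : ℕ) (ω : Ω), X (k + 1) ω = a (k + 1) * X k ω + u (k + 1) ω)
  (h : SlowGrowth a u P ω) {r : ℕ} (hr : r ∈ Finset.Icc 1 P)

theorem one_lt_abs_sq {q : ℝ} (hq : 1 < |q|) : 1 < |q ^ 2| := by
  rw [abs_pow]
  exact one_lt_pow₀ hq two_ne_zero

include ha hphi hX h hr

theorem SlowGrowth.tendsto_inv_pow_mul_pred :
    Tendsto (fun n => (parPhi a P ^ n)⁻¹ * X (n * P + r - 1) ω) atTop
      (𝓝 (coeffProd a 1 (r - 1) * (X 0 ω + parZeta a u P ω))) := by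
  obtain ⟨h1, h2⟩ := Finset.mem_Icc.1 hr
  have := h.tendsto_inv_pow_mul ha hphi hX (r := r - 1) (by omega)
  simpa only [Nat.add_sub_assoc h1] using this

theorem SlowGrowth.tendsto_lseEnergy :
    Tendsto (fun n => ((parPhi a P ^ 2) ^ n)⁻¹ * lseEnergy X P r n ω) atTop
      (𝓝 ((coeffProd a 1 (r - 1) * (X 0 ω + parZeta a u P ω)) ^ 2 / (parPhi a P ^ 2 - 1))) := by
  simp only [lseEnergy, inv_pow_mul_sum_eq_geomConv]
  refine tendsto_geomConv (one_lt_abs_sq hphi) ?_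
  refine ((h.tendsto_inv_pow_mul_pred ha hphi hX hr).pow 2).congr fun n => ?_
  rw [mul_pow, inv_pow, pow_right_comm]

/-- Each summand, scaled by `φ^{-2j}`, is `φ^{-j} X_{jP+r-1}`, which converges, times `φ^{-j}
u_{jP+r}`, which vanishes. -/
theorem SlowGrowth.tendsto_lseNoise_zero :
    Tendsto (fun n => ((parPhi a P ^ 2) ^ n)⁻¹ * lseNoise u X P r n ω) atTop (𝓝 0) := by
  simp only [lseNoise, inv_pow_mul_sum_eq_geomConv]
  have h1 := (h.tendsto_inv_pow_mul_pred ha hphi hX hr).mul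
    (h.tendsto_inv_pow_mul_innovation hphi hr)
  rw [mul_zero] at h1
  have h2 := tendsto_geomConv (one_lt_abs_sq hphi) h1
  rw [zero_div] at h2
  refine h2.congr fun n => ?_
  congr 1
  ext j
  rw [pow_right_comm, sq, mul_inv]
  ring

/-- This is where the rate `o(|φ|^{-j/2})` is needed: the error of the scaled process gains a factor
`√|φ|^j`, the innovation loses the same factor, and both still tend to `0`. The Toeplitz lemma then
handles the convolution of their product. -/
theorem SlowGrowth.tendsto_lseNoise_sub :
    Tendsto (fun n => (parPhi a P ^ n)⁻¹ * lseNoise u X P r n ω -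
      coeffProd a 1 (r - 1) * (X 0 ω + parZeta a u P ω) * seasonSum a u P r n ω)
      atTop (𝓝 0) := by
  obtain ⟨hr1, hr2⟩ := Finset.mem_Icc.1 hr
  have ht := one_lt_sqrt_abs hphi
  have h1 := (h.tendsto_sqrt_pow_mul_sub ha hphi hX (r := r - 1) (by omega)).mul
    (h.tendsto_inv_sqrt_pow_mul hr)
  rw [mul_zero] at h1
  have h2 := tendsto_geomConv hphi h1
  rw [zero_div] at h2
  refine h2.congr fun n => ?_
  rw [lseNoise, inv_pow_mul_sum_eq_geomConv, seasonSum, ← geomConv_const_mul, sub_eq_add_neg,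
    neg_eq_neg_one_mul, ← geomConv_const_mul, ← geomConv_add]
  congr 1
  ext j
  rw [Nat.add_sub_assoc hr1]
  have : √|parPhi a P| ^ j ≠ 0 := by positivity
  field_simp
  ring

variable (hY : X 0 ω + parZeta a u P ω ≠ 0)
include hY

omit ha hX h in
-- `A_1^{r-1}` is a factor of `φ ≠ 0`, so it cannot vanish.
theorem lseEnergy_limit_ne_zero :
    (coeffProd a 1 (r - 1) * (X 0 ω + parZeta a u P ω)) ^ 2 / (parPhi a P ^ 2 - 1) ≠ 0 := by
  have h0 : parPhi a P ≠ 0 := abs_pos.1 (by linarith)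
  have h1 : coeffProd a 1 (r - 1) ≠ 0 := fun h => h0 (by rw [← parPhi_eq_mul a hr, h]; ring)
  have h2 : parPhi a P ^ 2 - 1 ≠ 0 := by
    have := one_lt_abs_sq hphi
    rw [abs_of_nonneg (sq_nonneg _)] at this
    exact (sub_pos.2 this).ne'
  positivity

theorem SlowGrowth.eventually_lseEnergy_ne_zero : ∀ᶠ n in atTop, lseEnergy X P r n ω ≠ 0 := by
  filter_upwards [(h.tendsto_lseEnergy ha hphi hX hr).eventually_ne
    (lseEnergy_limit_ne_zero hphi hr hY)] with n hn h0
  rw [h0, mul_zero] at hn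
  exact hn rfl

theorem SlowGrowth.tendsto_lse : Tendsto (fun n => lse X P r n ω) atTop (𝓝 (a r)) := by
  have h0 : parPhi a P ≠ 0 := abs_pos.1 (by linarith)
  have h1 := (h.tendsto_lseNoise_zero ha hphi hX hr).div (h.tendsto_lseEnergy ha hphi hX hr)
    (lseEnergy_limit_ne_zero hphi hr hY)
  rw [zero_div] at h1
  rw [← tendsto_sub_nhds_zero_iff]
  refine h1.congr' ?_
  filter_upwards [h.eventually_lseEnergy_ne_zero ha hphi hX hr hY] with n hn
  rw [lse_sub ha hX (Finset.mem_Icc.1 hr).1 hn, Pi.div_apply, mul_div_mul_left]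
  positivity

omit hr in
theorem SlowGrowth.tendsto_phiTilde :
    Tendsto (fun n => phiTilde X P n ω) atTop (𝓝 (parPhi a P)) := by
  have : parPhi a P = ∏ r ∈ Finset.Icc 1 P, a r := by simp [parPhi, coeffProd]
  rw [this]
  exact tendsto_finsetProd _ fun r hr => h.tendsto_lse ha hphi hX hr hY

/-- The error of the product estimator, linearized in the errors of its factors. -/
noncomputable def prodWeight (a : ℕ → ℝ) (X : ℕ → Ω → ℝ) (P r n : ℕ) (ω : Ω) : ℝ :=
  (∏ j ∈ Finset.Icc 1 P with j < r, a j) * ∏ j ∈ Finset.Icc 1 P with r < j, lse X P j n ω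

omit ha hphi hX h hr hY in
-- A telescoping identity, exact rather than first order: the factors before `r` are already
-- replaced by the true coefficients, those after `r` are still estimators.
theorem phiTilde_sub_eq_sum (n : ℕ) : phiTilde X P n ω - parPhi a P =
    ∑ r ∈ Finset.Icc 1 P, (lse X P r n ω - a r) * prodWeight a X P r n ω := by
  have h1 := Finset.prod_sub_ordered (Finset.Icc 1 P) (fun r => lse X P r n ω)
    fun r => lse X P r n ω - a r
  simp only [sub_sub_cancel] at h1
  have h2 : parPhi a P = ∏ r ∈ Finset.Icc 1 P, a r := by simp [parPhi, coeffProd]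
  rw [h2, h1, phiTilde, sub_sub_cancel]
  exact Finset.sum_congr rfl fun r _ => by rw [prodWeight, mul_assoc]

theorem SlowGrowth.tendsto_prodWeight : Tendsto (fun n => prodWeight a X P r n ω) atTop
    (𝓝 (coeffProd a 1 (r - 1) * coeffProd a (r + 1) P)) := by
  obtain ⟨hr1, hr2⟩ := Finset.mem_Icc.1 hr
  have e1 : coeffProd a 1 (r - 1) = ∏ j ∈ Finset.Icc 1 P with j < r, a j := by
    rw [coeffProd, if_pos (by omega)]
    congr 1
    ext j
    simp only [Finset.mem_Icc, Finset.mem_filter]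
    omega
  have e2 : coeffProd a (r + 1) P = ∏ j ∈ Finset.Icc 1 P with r < j, a j := by
    rw [coeffProd, if_pos (by omega)]
    congr 1
    ext j
    simp only [Finset.mem_Icc, Finset.mem_filter]
    omega
  rw [e1, e2]
  exact (tendsto_finsetProd _ fun j hj =>
    h.tendsto_lse ha hphi hX (Finset.mem_filter.1 hj).1 hY).const_mul _

/-- The coefficient of the weighted innovations of season `r` in the error of the product
estimator approaches its limit. -/
theorem SlowGrowth.tendsto_seasonCoeff :
    Tendsto (fun n => prodWeight a X P r n ω * (((parPhi a P ^ 2) ^ n)⁻¹ * lseEnergy X P r n ω)⁻¹ *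
      (coeffProd a 1 (r - 1) * (X 0 ω + parZeta a u P ω)) -
      (parPhi a P ^ 2 - 1) / (X 0 ω + parZeta a u P ω) * coeffProd a (r + 1) P) atTop (𝓝 0) := by
  have hL := lseEnergy_limit_ne_zero hphi hr hY
  have h1 := ((h.tendsto_prodWeight ha hphi hX hr hY).mul
    ((h.tendsto_lseEnergy ha hphi hX hr).inv₀ hL)).mul_const
    (coeffProd a 1 (r - 1) * (X 0 ω + parZeta a u P ω))
  rw [← tendsto_sub_nhds_zero_iff] at h1
  have hA : coeffProd a 1 (r - 1) ≠ 0 := fun h0 => hL (by rw [h0]; simp)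
  have hq : parPhi a P ^ 2 - 1 ≠ 0 := fun h0 => hL (by rw [h0]; simp)
  refine h1.congr fun n => ?_
  congr 1
  field_simp

omit hr in
/-- The scaled error of the product estimator is asymptotically `(φ² - 1) / (X₀ + ζ)` times the
weighted sum of the innovations, up to an error that is small relative to these innovations. -/
theorem SlowGrowth.tendsto_error_div : Tendsto (fun n =>
    (parPhi a P ^ n * (phiTilde X P n ω - parPhi a P) -
      (parPhi a P ^ 2 - 1) / (X 0 ω + parZeta a u P ω) * blockSum a u P n ω) /
      (1 + ∑ r ∈ Finset.Icc 1 P, |seasonSum a u P r n ω|)) atTop (𝓝 0) := by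
  have h0 : parPhi a P ≠ 0 := abs_pos.1 (by linarith)
  set Y := X 0 ω + parZeta a u P ω with hYdef
  set W : ℕ → ℕ → ℝ := fun r n =>
    prodWeight a X P r n ω * (((parPhi a P ^ 2) ^ n)⁻¹ * lseEnergy X P r n ω)⁻¹ with hW
  set e : ℕ → ℕ → ℝ := fun r n => W r n * ((parPhi a P ^ n)⁻¹ * lseNoise u X P r n ω -
      coeffProd a 1 (r - 1) * Y * seasonSum a u P r n ω) with he
  set c : ℕ → ℕ → ℝ := fun r n => W r n * (coeffProd a 1 (r - 1) * Y) -
      (parPhi a P ^ 2 - 1) / Y * coeffProd a (r + 1) P with hc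
  have he0 : ∀ r ∈ Finset.Icc 1 P, Tendsto (e r) atTop (𝓝 0) := fun r hr => by
    have := ((h.tendsto_prodWeight ha hphi hX hr hY).mul
      ((h.tendsto_lseEnergy ha hphi hX hr).inv₀ (lseEnergy_limit_ne_zero hphi hr hY))).mul
      (h.tendsto_lseNoise_sub ha hphi hX hr)
    rwa [mul_zero] at this
  have hc0 : ∀ r ∈ Finset.Icc 1 P, Tendsto (c r) atTop (𝓝 0) := fun r hr =>
    h.tendsto_seasonCoeff ha hphi hX hr hY
  have hlim : Tendsto (fun n => ∑ r ∈ Finset.Icc 1 P, (|e r n| + |c r n|)) atTop (𝓝 0) := by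
    rw [← Finset.sum_const_zero (s := Finset.Icc 1 P)]
    refine tendsto_finsetSum _ fun r hr => ?_
    simpa using (he0 r hr).abs.add (hc0 r hr).abs
  refine squeeze_zero_norm' ?_ hlim
  have hE : ∀ᶠ n in atTop, ∀ r ∈ Finset.Icc 1 P, lseEnergy X P r n ω ≠ 0 :=
    (Finset.eventually_all _).2 fun r hr => h.eventually_lseEnergy_ne_zero ha hphi hX hr hY
  filter_upwards [hE] with n hn
  set S := ∑ r ∈ Finset.Icc 1 P, |seasonSum a u P r n ω| with hS
  have hS0 : 0 ≤ S := Finset.sum_nonneg fun _ _ => abs_nonneg _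
  -- `e` collects the errors in the noise and `c` those in the random coefficients. Only `c`
  -- multiplies the weighted innovations, which explains the normalization by `1 + S`.
  have key : parPhi a P ^ n * (phiTilde X P n ω - parPhi a P) -
      (parPhi a P ^ 2 - 1) / Y * blockSum a u P n ω =
      ∑ r ∈ Finset.Icc 1 P, (e r n + c r n * seasonSum a u P r n ω) := by
    rw [phiTilde_sub_eq_sum, blockSum_eq_sum, Finset.mul_sum, Finset.mul_sum,
      ← Finset.sum_sub_distrib]
    refine Finset.sum_congr rfl fun r hr => ?_
    have hEr := hn r hr
    rw [lse_sub ha hX (Finset.mem_Icc.1 hr).1 hEr]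
    have hpow : parPhi a P ^ n * (lseNoise u X P r n ω / lseEnergy X P r n ω *
        prodWeight a X P r n ω) = W r n * ((parPhi a P ^ n)⁻¹ * lseNoise u X P r n ω) := by
      simp only [hW]
      rw [pow_right_comm]
      field_simp
    rw [hpow]
    simp only [he, hc]
    ring
  rw [key, norm_div, Real.norm_eq_abs, Real.norm_of_nonneg (by positivity),
    div_le_iff₀ (by positivity), Finset.sum_mul]
  refine (Finset.abs_sum_le_sum_abs _ _).trans (Finset.sum_le_sum fun r hr => ?_)
  have hle : |seasonSum a u P r n ω| ≤ S :=
    Finset.single_le_sum (f := fun r => |seasonSum a u P r n ω|) (fun _ _ => abs_nonneg _) hr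
  calc |e r n + c r n * seasonSum a u P r n ω|
      ≤ |e r n| + |c r n| * |seasonSum a u P r n ω| := by
        rw [← abs_mul]; exact abs_add_le _ _
    _ ≤ |e r n| * (1 + S) + |c r n| * (1 + S) := by
        gcongr
        · exact le_mul_of_one_le_right (abs_nonneg _) (by linarith)
        · linarith
    _ = _ := by ring

end LeastSquares

/-! ### Covariance and characteristic function inequalities under strong mixing -/

section Mixing

variable {Ω : Type*} {m m₁ m₂ m₀ : MeasurableSpace Ω} {μ : Measure Ω} [IsProbabilityMeasure μ]

/-- Conditioning on `m` replaces `h` by `μ[h|m]`, and `|f| ≤ 1` bounds the integral by the `L¹` norm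
of `μ[h|m]`. Splitting by its sign yields two sets of `m`, each contributing at most `α`. -/
theorem abs_integral_mul_le_of_abs_setIntegral_le (hm : m ≤ m₀) {f h : Ω → ℝ} {α : ℝ}
    (hh : Integrable h μ) (hα : ∀ A, MeasurableSet[m] A → |∫ ω in A, h ω ∂μ| ≤ α)
    (hf : Measurable[m] f) (hf1 : ∀ ω, |f ω| ≤ 1) : |∫ ω, f ω * h ω ∂μ| ≤ 2 * α := by
  have hfs : StronglyMeasurable[m] f := hf.stronglyMeasurable
  have hfh : Integrable (f * h) μ :=
    hh.bdd_mul (hf.mono hm le_rfl).aestronglyMeasurable (ae_of_all _ hf1)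
  have hce : μ[f * h|m] =ᵐ[μ] f * μ[h|m] := condExp_mul_of_stronglyMeasurable_left hfs hfh hh
  have e1 : ∫ ω, f ω * h ω ∂μ = ∫ ω, f ω * (μ[h|m]) ω ∂μ := by
    have := integral_condExp hm (μ := μ) (f := f * h)
    rw [integral_congr_ae hce] at this
    exact this.symm
  have hci : Integrable (μ[h|m]) μ := integrable_condExp
  have hfc : Integrable (fun ω => f ω * (μ[h|m]) ω) μ :=
    hci.bdd_mul (hf.mono hm le_rfl).aestronglyMeasurable (ae_of_all _ hf1)
  set A : Set Ω := {ω | 0 ≤ (μ[h|m]) ω} with hA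
  have hAm : MeasurableSet[m] A :=
    (stronglyMeasurable_condExp.measurable : Measurable[m] (μ[h|m])) measurableSet_Ici
  rw [e1]
  calc |∫ ω, f ω * (μ[h|m]) ω ∂μ| ≤ ∫ ω, |f ω * (μ[h|m]) ω| ∂μ := abs_integral_le_integral_abs
    _ ≤ ∫ ω, |(μ[h|m]) ω| ∂μ := by
        refine integral_mono hfc.abs hci.abs fun ω => ?_
        simp only [abs_mul]
        exact mul_le_of_le_one_left (abs_nonneg _) (hf1 ω)
    _ = ∫ ω in A, |(μ[h|m]) ω| ∂μ + ∫ ω in Aᶜ, |(μ[h|m]) ω| ∂μ :=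
        (integral_add_compl (hm _ hAm) hci.abs).symm
    _ = ∫ ω in A, (μ[h|m]) ω ∂μ + ∫ ω in Aᶜ, -(μ[h|m]) ω ∂μ := by
        congr 1
        · exact setIntegral_congr_fun (hm _ hAm) fun ω hω => abs_of_nonneg hω
        · exact setIntegral_congr_fun (hm _ hAm.compl) fun ω hω => abs_of_neg (not_le.1 hω)
    _ = ∫ ω in A, h ω ∂μ - ∫ ω in Aᶜ, h ω ∂μ := by
        rw [integral_neg, setIntegral_condExp hm hh hAm, setIntegral_condExp hm hh hAm.compl,
          sub_eq_add_neg]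
    _ ≤ α + α := by
        have h1 := abs_le.1 (hα A hAm)
        have h2 := abs_le.1 (hα Aᶜ hAm.compl)
        linarith [h1.2, h2.1]
    _ = 2 * α := by ring

/-- Covariance inequality for bounded functions under strong mixing. -/
theorem abs_integral_mul_sub_le (hm₁ : m₁ ≤ m₀) (hm₂ : m₂ ≤ m₀) {α : ℝ}
    (hα : ∀ A B, MeasurableSet[m₁] A → MeasurableSet[m₂] B →
      |μ.real (A ∩ B) - μ.real A * μ.real B| ≤ α)
    {f g : Ω → ℝ} (hf : Measurable[m₁] f) (hg : Measurable[m₂] g)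
    (hf1 : ∀ ω, |f ω| ≤ 1) (hg1 : ∀ ω, |g ω| ≤ 1) :
    |∫ ω, f ω * g ω ∂μ - (∫ ω, f ω ∂μ) * ∫ ω, g ω ∂μ| ≤ 4 * α := by
  have hfi : Integrable f μ :=
    Integrable.of_bound (hf.mono hm₁ le_rfl).aestronglyMeasurable 1 (ae_of_all _ hf1)
  have hgi : Integrable g μ :=
    Integrable.of_bound (hg.mono hm₂ le_rfl).aestronglyMeasurable 1 (ae_of_all _ hg1)
  -- The preceding bound is used twice: here with `h = 1_B - μ(B)` to pass from sets `A` to the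
  -- function `f`, then with `h = f - E f` to pass from sets `B` to `g`. Each use doubles the
  -- constant.
  have step : ∀ B, MeasurableSet[m₂] B → |∫ ω in B, (f ω - ∫ ω', f ω' ∂μ) ∂μ| ≤ 2 * α := by
    intro B hB
    have hB' := hm₂ _ hB
    have hi : Integrable (B.indicator fun _ => (1 : ℝ)) μ := (integrable_const 1).indicator hB'
    have h1 : |∫ ω, f ω * (B.indicator (fun _ => (1 : ℝ)) ω - μ.real B) ∂μ| ≤ 2 * α := by
      refine abs_integral_mul_le_of_abs_setIntegral_le hm₁ (hi.sub (integrable_const _))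
        (fun A hA => ?_) hf hf1
      rw [integral_sub hi.integrableOn (integrable_const _).integrableOn,
        setIntegral_indicator hB']
      simpa using hα A B hA hB
    convert h1 using 2
    simp only [mul_sub]
    rw [integral_sub hfi.integrableOn (integrable_const _).integrableOn,
      integral_sub _ (hfi.mul_const _), integral_mul_const, ← integral_indicator hB']
    · congr 1
      · refine integral_congr_ae (ae_of_all _ fun ω => ?_)
        by_cases h : ω ∈ B <;> simp [h]
      · simp [mul_comm]
    · exact hfi.mul_bdd (c := 1) hi.aestronglyMeasurable (ae_of_all _ fun ω => by
        by_cases h : ω ∈ B <;> simp [h])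
  have h2 := abs_integral_mul_le_of_abs_setIntegral_le hm₂ (hfi.sub (integrable_const _))
    step hg hg1
  convert h2 using 1
  · congr 1
    simp only [Pi.sub_apply, mul_sub]
    rw [integral_sub, integral_mul_const]
    · simp only [mul_comm]
    · exact hfi.bdd_mul (hg.mono hm₂ le_rfl).aestronglyMeasurable (ae_of_all _ hg1)
    · exact hgi.mul_const _
  · ring

theorem integral_exp_mul_I_eq {f : Ω → ℝ} (hf : Measurable f) :
    ∫ ω, Complex.exp (f ω * Complex.I) ∂μ =
      ((∫ ω, Real.cos (f ω) ∂μ : ℝ) : ℂ) + ((∫ ω, Real.sin (f ω) ∂μ : ℝ) : ℂ) * Complex.I := by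
  have h1 : Integrable (fun ω => Real.cos (f ω)) μ :=
    Integrable.of_bound (by fun_prop) 1 (ae_of_all _ fun ω => Real.abs_cos_le_one _)
  have h2 : Integrable (fun ω => Real.sin (f ω)) μ :=
    Integrable.of_bound (by fun_prop) 1 (ae_of_all _ fun ω => Real.abs_sin_le_one _)
  simp only [Complex.exp_mul_I, ← Complex.ofReal_cos, ← Complex.ofReal_sin]
  rw [integral_add h1.ofReal (h2.ofReal.mul_const _), integral_mul_const,
    integral_complex_ofReal, integral_complex_ofReal]

/-- The addition formulas make the real and imaginary parts combinations of two covariances each,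
every one at most `4 α`; hence `16 = 2 · (4 + 4)`. -/
theorem norm_integral_exp_add_sub_le (hm₁ : m₁ ≤ m₀) (hm₂ : m₂ ≤ m₀) {α : ℝ}
    (hα : ∀ A B, MeasurableSet[m₁] A → MeasurableSet[m₂] B →
      |μ.real (A ∩ B) - μ.real A * μ.real B| ≤ α)
    {f g : Ω → ℝ} (hf : Measurable[m₁] f) (hg : Measurable[m₂] g) :
    ‖∫ ω, Complex.exp ((f ω + g ω : ℝ) * Complex.I) ∂μ -
      (∫ ω, Complex.exp (f ω * Complex.I) ∂μ) * ∫ ω, Complex.exp (g ω * Complex.I) ∂μ‖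
      ≤ 16 * α := by
  have hf' : Measurable f := hf.mono hm₁ le_rfl
  have hg' : Measurable g := hg.mono hm₂ le_rfl
  have hfg' : Measurable fun ω => f ω + g ω := hf'.add hg'
  rw [integral_exp_mul_I_eq hfg', integral_exp_mul_I_eq hf', integral_exp_mul_I_eq hg']
  have cf : Measurable[m₁] fun ω => Real.cos (f ω) := Real.measurable_cos.comp hf
  have sf : Measurable[m₁] fun ω => Real.sin (f ω) := Real.measurable_sin.comp hf
  have cg : Measurable[m₂] fun ω => Real.cos (g ω) := Real.measurable_cos.comp hg
  have sg : Measurable[m₂] fun ω => Real.sin (g ω) := Real.measurable_sin.comp hg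
  have hcc := abs_integral_mul_sub_le hm₁ hm₂ hα cf cg (fun _ => Real.abs_cos_le_one _)
    fun _ => Real.abs_cos_le_one _
  have hss := abs_integral_mul_sub_le hm₁ hm₂ hα sf sg (fun _ => Real.abs_sin_le_one _)
    fun _ => Real.abs_sin_le_one _
  have hcs := abs_integral_mul_sub_le hm₁ hm₂ hα cf sg (fun _ => Real.abs_cos_le_one _)
    fun _ => Real.abs_sin_le_one _
  have hsc := abs_integral_mul_sub_le hm₁ hm₂ hα sf cg (fun _ => Real.abs_sin_le_one _)
    fun _ => Real.abs_cos_le_one _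
  have bd : ∀ {F G : Ω → ℝ}, Measurable F → Measurable G → (∀ ω, |F ω| ≤ 1) → (∀ ω, |G ω| ≤ 1) →
      Integrable (fun ω => F ω * G ω) μ := fun hF hG hF1 hG1 =>
    Integrable.of_bound (hF.mul hG).aestronglyMeasurable 1 (ae_of_all _ fun ω => by
      rw [Real.norm_eq_abs, abs_mul]
      exact mul_le_one₀ (hF1 ω) (abs_nonneg _) (hG1 ω))
  have hcos : ∫ ω, Real.cos (f ω + g ω) ∂μ = ∫ ω, Real.cos (f ω) * Real.cos (g ω) ∂μ -
      ∫ ω, Real.sin (f ω) * Real.sin (g ω) ∂μ := by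
    simp only [Real.cos_add]
    exact integral_sub (bd (by fun_prop) (by fun_prop) (fun _ => Real.abs_cos_le_one _)
      fun _ => Real.abs_cos_le_one _) (bd (by fun_prop) (by fun_prop)
      (fun _ => Real.abs_sin_le_one _) fun _ => Real.abs_sin_le_one _)
  have hsin : ∫ ω, Real.sin (f ω + g ω) ∂μ = ∫ ω, Real.sin (f ω) * Real.cos (g ω) ∂μ +
      ∫ ω, Real.cos (f ω) * Real.sin (g ω) ∂μ := by
    simp only [Real.sin_add]
    exact integral_add (bd (by fun_prop) (by fun_prop) (fun _ => Real.abs_sin_le_one _)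
      fun _ => Real.abs_cos_le_one _) (bd (by fun_prop) (by fun_prop)
      (fun _ => Real.abs_cos_le_one _) fun _ => Real.abs_sin_le_one _)
  rw [hcos, hsin]
  refine (Complex.norm_le_abs_re_add_abs_im _).trans ?_
  simp only [Complex.sub_re, Complex.add_re, Complex.ofReal_re, Complex.mul_re, Complex.I_re,
    mul_zero, Complex.ofReal_im, Complex.I_im, mul_one, sub_self, add_zero, Complex.add_im,
    Complex.mul_im, zero_add, Complex.sub_im]
  rw [abs_le] at hcc hss hcs hsc
  rw [show (16 : ℝ) * α = 8 * α + 8 * α by ring]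
  exact add_le_add (abs_le.2 ⟨by linarith, by linarith⟩) (abs_le.2 ⟨by linarith, by linarith⟩)

end Mixing

/-! ### Tools for convergence in distribution and in probability -/

section Convergence

variable {Ω : Type*} {m₀ : MeasurableSpace Ω} {μ : Measure Ω} [IsProbabilityMeasure μ]

omit [IsProbabilityMeasure μ] in
theorem charFun_map_real {f : Ω → ℝ} (hf : AEMeasurable f μ) (t : ℝ) :
    charFun (μ.map f) t = ∫ ω, Complex.exp ((t * f ω : ℝ) * Complex.I) ∂μ := by
  rw [charFun_apply_real, integral_map hf (by fun_prop)]
  simp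

omit [IsProbabilityMeasure μ] in
theorem charFun_map_prod {f g : Ω → ℝ} (hf : AEMeasurable f μ) (hg : AEMeasurable g μ)
    (t : WithLp 2 (ℝ × ℝ)) :
    charFun (μ.map fun ω => WithLp.toLp 2 (f ω, g ω)) t =
      ∫ ω, Complex.exp ((t.fst * f ω + t.snd * g ω : ℝ) * Complex.I) ∂μ := by
  rw [charFun_apply, integral_map (by fun_prop) (by fun_prop)]
  simp [WithLp.prod_inner_apply]

/-- Two sequences that converge in distribution and are asymptotically independent converge
jointly. -/
theorem tendstoInDistribution_prodMk_of_asymptotically_independent {f g : ℕ → Ω → ℝ}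
    {F G : Ω → ℝ} (hf : TendstoInDistribution f atTop F (fun _ => μ) μ)
    (hg : TendstoInDistribution g atTop G (fun _ => μ) μ) (hFG : IndepFun F G μ)
    (h : ∀ s t : ℝ, Tendsto (fun n =>
      ∫ ω, Complex.exp ((s * f n ω + t * g n ω : ℝ) * Complex.I) ∂μ -
        (∫ ω, Complex.exp ((s * f n ω : ℝ) * Complex.I) ∂μ) *
          ∫ ω, Complex.exp ((t * g n ω : ℝ) * Complex.I) ∂μ) atTop (𝓝 0)) :
    TendstoInDistribution (fun n ω => (f n ω, g n ω)) atTop (fun ω => (F ω, G ω))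
      (fun _ => μ) μ := by
  have hfm := hf.forall_aemeasurable
  have hgm := hg.forall_aemeasurable
  have hFm := hf.aemeasurable_limit
  have hGm := hg.aemeasurable_limit
  -- `ℝ × ℝ` carries the sup norm, so Lévy's continuity theorem is applied on `WithLp 2 (ℝ × ℝ)`,
  -- which has an inner product; the continuous map `WithLp.ofLp` leads back.
  have key : TendstoInDistribution (fun n ω => WithLp.toLp 2 (f n ω, g n ω)) atTop
      (fun ω => WithLp.toLp 2 (F ω, G ω)) (fun _ => μ) μ := by
    refine ⟨fun n => by fun_prop, by fun_prop,
      ProbabilityMeasure.tendsto_of_tendsto_charFun fun t => ?_⟩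
    have h1 := (ProbabilityMeasure.tendsto_iff_tendsto_charFun.1 hf.tendsto) t.fst
    have h2 := (ProbabilityMeasure.tendsto_iff_tendsto_charFun.1 hg.tendsto) t.snd
    have h3 := (h1.mul h2).add (h t.fst t.snd)
    simp only [ProbabilityMeasure.coe_mk] at h3 ⊢
    rw [(indepFun_iff_charFun_prod hFm hGm).1 hFG t]
    rw [add_zero] at h3
    refine h3.congr fun n => ?_
    rw [charFun_map_real (hfm n), charFun_map_real (hgm n), charFun_map_prod (hfm n) (hgm n)]
    ring
  exact key.continuous_comp (g := WithLp.ofLp) (by fun_prop)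

/-- If `D / (1 + S) → 0` almost surely for a nonnegative sequence `S` bounded in `L¹`, then
`D → 0` in probability. -/
theorem tendstoInMeasure_zero_of_div {D S : ℕ → Ω → ℝ} {C : ℝ} (hD : ∀ n, Measurable (D n))
    (hS : ∀ n, Measurable (S n)) (hS0 : ∀ n ω, 0 ≤ S n ω) (hSi : ∀ n, Integrable (S n) μ)
    (hC : ∀ n, ∫ ω, S n ω ∂μ ≤ C)
    (h : ∀ᵐ ω ∂μ, Tendsto (fun n => D n ω / (1 + S n ω)) atTop (𝓝 0)) :
    TendstoInMeasure μ D atTop 0 := by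
  have hC0 : 0 ≤ C := (integral_nonneg (hS0 0)).trans (hC 0)
  have hQ : TendstoInMeasure μ (fun n ω => D n ω / (1 + S n ω)) atTop 0 :=
    tendstoInMeasure_of_tendsto_ae
      (fun n => ((hD n).div ((hS n).const_add 1)).aestronglyMeasurable) h
  rw [tendstoInMeasure_iff_measureReal_norm] at hQ ⊢
  intro ε hε
  simp only [Pi.zero_apply, sub_zero] at hQ ⊢
  rw [Metric.tendsto_nhds]
  intro η hη
  -- Chosen so that Markov's inequality gives `μ(1 + S ≥ ε/δ) ≤ (1 + C) δ / ε = η / 2`. If `1 + S <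
  -- ε/δ` and the quotient is below `δ`, then `|D| < ε`.
  set δ := η * ε / (2 * (1 + C)) with hδ
  have hδ0 : 0 < δ := by positivity
  filter_upwards [(hQ δ hδ0).eventually_lt_const (half_pos hη)] with n hn
  rw [Real.dist_eq, sub_zero, abs_of_nonneg measureReal_nonneg]
  have hsub : {ω | ε ≤ ‖D n ω‖} ⊆ {ω | δ ≤ ‖D n ω / (1 + S n ω)‖} ∪ {ω | ε / δ ≤ 1 + S n ω} := by
    intro ω hω
    by_contra hcon
    simp only [Set.mem_union, Set.mem_ofPred_eq, not_or, not_le] at hcon hω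
    have hp : 0 < 1 + S n ω := by linarith [hS0 n ω]
    rw [norm_div, Real.norm_of_nonneg hp.le, div_lt_iff₀ hp] at hcon
    have h3 := (lt_div_iff₀ hδ0).1 hcon.2
    linarith [hcon.1]
  have hmk : ε / δ * μ.real {ω | ε / δ ≤ 1 + S n ω} ≤ 1 + C := by
    refine (mul_meas_ge_le_integral_of_nonneg (ae_of_all _ fun ω => ?_)
      ((integrable_const 1).add (hSi n)) _).trans ?_
    · simpa using add_nonneg zero_le_one (hS0 n ω)
    · simp only [Pi.add_apply]
      rw [integral_add (integrable_const 1) (hSi n)]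
      simpa using hC n
  have hb : μ.real {ω | ε / δ ≤ 1 + S n ω} ≤ η / 2 := by
    have e : ε / δ = 2 * (1 + C) / η := by
      rw [hδ]; field_simp
    rw [e, div_mul_eq_mul_div, div_le_iff₀ hη] at hmk
    rw [e]
    nlinarith
  calc μ.real {ω | ε ≤ ‖D n ω‖} ≤ _ := measureReal_mono hsub
    _ ≤ _ := measureReal_union_le _ _
    _ < η / 2 + η / 2 := add_lt_add_of_lt_of_le hn hb
    _ = η := by ring

omit [IsProbabilityMeasure μ] in
-- The `L¹` norms of the terms are summable, so the series of absolute values is finite almost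
-- everywhere.
theorem ae_summable_mul_abs {f : ℕ → Ω → ℝ} {C : ℝ} (hf : ∀ l, Integrable (f l) μ)
    (hC : ∀ l, ∫ ω, |f l ω| ∂μ ≤ C) {c : ℕ → ℝ} (hc0 : ∀ l, 0 ≤ c l) (hc : Summable c) :
    ∀ᵐ ω ∂μ, Summable fun l => c l * |f l ω| := by
  have hs : Summable fun l => ∫ ω, ‖c l * f l ω‖ ∂μ := by
    refine (hc.mul_right C).of_nonneg_of_le (fun l => by positivity) fun l => ?_
    simp only [norm_mul, Real.norm_eq_abs, integral_const_mul, abs_of_nonneg (hc0 l)]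
    exact mul_le_mul_of_nonneg_left (hC l) (hc0 l)
  have h1 : ∑' l, eLpNorm (fun ω => c l * f l ω) 1 μ ≠ ⊤ := by
    simp only [eLpNorm_one_eq_lintegral_enorm]
    simp only [← ofReal_integral_norm_eq_lintegral_enorm ((hf _).const_mul _)]
    exact hs.tsum_ofReal_ne_top
  filter_upwards [summable_norm_of_tsum_eLpNorm_ne_top le_rfl
    (fun l => ((hf l).const_mul (c l)).aestronglyMeasurable) h1] with ω hω
  refine hω.congr fun l => ?_
  rw [norm_mul, Real.norm_eq_abs, Real.norm_eq_abs, abs_of_nonneg (hc0 l)]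

end Convergence

/-! ### First moment bounds and almost sure summability -/

section Moments

variable {Ω : Type*} {m₀ : MeasurableSpace Ω} {μ : Measure Ω} {a : ℕ → ℝ} {u X : ℕ → Ω → ℝ} {P : ℕ}

theorem integrable_geomConv {q : ℝ} {x : ℕ → Ω → ℝ} (hx : ∀ j, Integrable (x j) μ) (n : ℕ) :
    Integrable (fun ω => geomConv q (fun j => x j ω) n) μ :=
  integrable_finsetSum _ fun j _ => (hx j).const_mul _

theorem integral_abs_geomConv_le {q C : ℝ} (hq : 1 < |q|) {x : ℕ → Ω → ℝ}
    (hx : ∀ j, Integrable (x j) μ) (hC : ∀ j, ∫ ω, |x j ω| ∂μ ≤ C) (n : ℕ) :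
    ∫ ω, |geomConv q (fun j => x j ω) n| ∂μ ≤ (|q| - 1)⁻¹ * C := by
  have hC0 : 0 ≤ C := (integral_nonneg fun _ => abs_nonneg _).trans (hC 0)
  have hq0 : 0 < |q| := by linarith
  have hs := hasSum_inv_pow_succ (q := |q|) (by simpa using hq)
  calc ∫ ω, |geomConv q (fun j => x j ω) n| ∂μ
      ≤ ∫ ω, ∑ j ∈ Finset.range n, (|q| ^ (n - j))⁻¹ * |x j ω| ∂μ := by
        refine integral_mono (integrable_geomConv hx n).abs
          (integrable_finsetSum _ fun j _ => (hx j).abs.const_mul _) fun ω => ?_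
        refine (Finset.abs_sum_le_sum_abs _ _).trans (le_of_eq ?_)
        exact Finset.sum_congr rfl fun j _ => by rw [abs_mul, abs_inv, abs_pow]
    _ = ∑ j ∈ Finset.range n, (|q| ^ (n - j))⁻¹ * ∫ ω, |x j ω| ∂μ := by
        rw [integral_finsetSum _ fun j _ => (hx j).abs.const_mul _]
        simp only [integral_const_mul]
    _ ≤ ∑ j ∈ Finset.range n, (|q| ^ (n - j))⁻¹ * C := by
        gcongr with j _
        exact hC j
    _ = (∑ k ∈ Finset.range n, (|q| ^ (k + 1))⁻¹) * C := by
        rw [← Finset.sum_mul, ← Finset.sum_range_reflect]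
        congr 1
        refine Finset.sum_congr rfl fun k hk => ?_
        have := Finset.mem_range.1 hk
        congr 2
        omega
    _ ≤ (|q| - 1)⁻¹ * C := by
        gcongr
        exact sum_le_hasSum _ (fun _ _ => by positivity) hs

/-- The absolute moments are periodic in `k`, so their sum over one period bounds all of them. -/
theorem exists_integral_abs_le [IsFiniteMeasure μ] (hP : 0 < P)
    (hu_per : ∀ s m : ℕ, 1 ≤ s →
      IdentDistrib (fun ω (i : Fin m) => u (P + s + i) ω) (fun ω (i : Fin m) => u (s + i) ω) μ μ) :
    ∃ C, ∀ k, 1 ≤ k → ∫ ω, |u k ω| ∂μ ≤ C := by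
  have hper : ∀ s, 1 ≤ s → ∫ ω, |u (P + s) ω| ∂μ = ∫ ω, |u s ω| ∂μ := fun s hs => by
    have h := (hu_per s 1 hs).comp (u := fun v : Fin 1 → ℝ => |v 0|) (by fun_prop)
    simpa using! h.integral_eq
  refine ⟨∑ s ∈ Finset.Icc 1 P, ∫ ω, |u s ω| ∂μ, fun k => ?_⟩
  induction k using Nat.strong_induction_on with
  | _ k ih =>
    intro hk
    rcases le_or_gt k P with h | h
    · exact Finset.single_le_sum (f := fun s => ∫ ω, |u s ω| ∂μ)
        (fun s _ => integral_nonneg fun _ => abs_nonneg _) (Finset.mem_Icc.2 ⟨hk, h⟩)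
    · rw [show k = P + (k - P) by omega, hper _ (by omega)]
      exact ih (k - P) (by omega) (by omega)

theorem integrable_parU (hu : ∀ k, 1 ≤ k → Integrable (u k) μ) (n r : ℕ) :
    Integrable (parU a u P n r) μ :=
  integrable_finsetSum _ fun s hs =>
    (hu _ (by have := (Finset.mem_Icc.1 hs).1; omega)).const_mul _

theorem integral_abs_parU_le (hu : ∀ k, 1 ≤ k → Integrable (u k) μ) {C : ℝ}
    (hC : ∀ k, 1 ≤ k → ∫ ω, |u k ω| ∂μ ≤ C) (n r : ℕ) :
    ∫ ω, |parU a u P n r ω| ∂μ ≤ ∑ s ∈ Finset.Icc 1 r, |coeffProd a (s + 1) r| * C := by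
  have hk : ∀ s ∈ Finset.Icc 1 r, 1 ≤ n * P + s := fun s hs => by
    have := (Finset.mem_Icc.1 hs).1
    omega
  have hi : ∀ s ∈ Finset.Icc 1 r,
      Integrable (fun ω => |coeffProd a (s + 1) r| * |u (n * P + s) ω|) μ := fun s hs =>
    (hu _ (hk s hs)).abs.const_mul _
  calc ∫ ω, |parU a u P n r ω| ∂μ
      ≤ ∫ ω, ∑ s ∈ Finset.Icc 1 r, |coeffProd a (s + 1) r| * |u (n * P + s) ω| ∂μ := by
        refine integral_mono (integrable_parU hu n r).abs (integrable_finsetSum _ hi) fun ω => ?_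
        refine (Finset.abs_sum_le_sum_abs _ _).trans (le_of_eq ?_)
        exact Finset.sum_congr rfl fun j _ => abs_mul _ _
    _ = ∑ s ∈ Finset.Icc 1 r, |coeffProd a (s + 1) r| * ∫ ω, |u (n * P + s) ω| ∂μ := by
        rw [integral_finsetSum _ hi]
        simp only [integral_const_mul]
    _ ≤ _ := by
        gcongr with s hs
        exact hC _ (hk s hs)

theorem ae_slowGrowth (hphi : 1 < |parPhi a P|) (hu : ∀ k, 1 ≤ k → Integrable (u k) μ) {C : ℝ}
    (hC : ∀ k, 1 ≤ k → ∫ ω, |u k ω| ∂μ ≤ C) : ∀ᵐ ω ∂μ, SlowGrowth a u P ω := by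
  refine (Finset.eventually_all _).2 fun s hs => ?_
  have h1 := (Finset.mem_Icc.1 hs).1
  refine ae_summable_mul_abs (fun l => hu _ (by omega)) (fun l => hC _ (by omega))
    (fun l => by positivity) ?_
  simp only [← inv_pow]
  exact summable_geometric_of_lt_one (by positivity) (inv_lt_one_of_one_lt₀ (one_lt_sqrt_abs hphi))

theorem ae_summable_starTerm {ustar : ℕ → Ω → ℝ} (hphi : 1 < |parPhi a P|)
    (hu : ∀ k, Integrable (ustar k) μ) {C : ℝ} (hC : ∀ k, ∫ ω, |ustar k ω| ∂μ ≤ C) :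
    ∀ᵐ ω ∂μ, ∀ r ∈ Finset.Icc 1 P, Summable fun j : ℕ => starTerm a ustar P r (j + 1) ω := by
  refine (Finset.eventually_all _).2 fun r _ => ?_
  have hc := (hasSum_inv_pow_succ (q := |parPhi a P|) (by simpa using hphi)).summable
  filter_upwards [ae_summable_mul_abs (fun l => hu ((l + 1) * P - r)) (fun l => hC _)
    (fun l => by positivity) hc] with ω hω
  refine Summable.of_norm (hω.congr fun l => ?_)
  rw [starTerm, norm_mul, norm_inv, norm_pow, Real.norm_eq_abs, Real.norm_eq_abs]

end Moments

/-! ### Past and future σ-fields and the gap between them -/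

section Fields

variable {Ω : Type*} {m₀ : MeasurableSpace Ω} {μ : Measure Ω} {a : ℕ → ℝ} {u X : ℕ → Ω → ℝ} {P : ℕ}

theorem pastField_le {Y : Ω → ℝ} (hY : Measurable Y) (hu : ∀ k, 1 ≤ k → Measurable (u k)) (k : ℕ) :
    pastField Y u k ≤ m₀ :=
  sup_le hY.comap_le (iSup₂_le fun j hj => (hu j hj.1).comap_le)

theorem futureField_le (hu : ∀ k, 1 ≤ k → Measurable (u k)) (k : ℕ) : futureField u k ≤ m₀ :=
  iSup₂_le fun j hj => (hu j hj.1).comap_le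

theorem pastField_mono (Y : Ω → ℝ) {k l : ℕ} (h : k ≤ l) : pastField Y u k ≤ pastField Y u l :=
  sup_le_sup_left (iSup₂_le fun j hj =>
    le_iSup₂_of_le (f := fun (j : ℕ) (_ : 1 ≤ j ∧ j ≤ l) =>
      MeasurableSpace.comap (u j) inferInstance) j ⟨hj.1, hj.2.trans h⟩ le_rfl) _

theorem measurable_futureField {m j : ℕ} (h1 : 1 ≤ j) (hm : m ≤ j) :
    Measurable[futureField u m] (u j) :=
  measurable_iff_comap_le.2 (le_iSup₂_of_le (f := fun (j : ℕ) (_ : 1 ≤ j ∧ m ≤ j) =>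
      MeasurableSpace.comap (u j) inferInstance) j ⟨h1, hm⟩ le_rfl)

theorem measurable_pastField {Y : Ω → ℝ} {k j : ℕ} (h1 : 1 ≤ j) (hk : j ≤ k) :
    Measurable[pastField Y u k] (u j) :=
  measurable_iff_comap_le.2 (le_sup_of_le_right
    (le_iSup₂_of_le (f := fun (j : ℕ) (_ : 1 ≤ j ∧ j ≤ k) =>
      MeasurableSpace.comap (u j) inferInstance) j ⟨h1, hk⟩ le_rfl))

theorem measurable_pastField_apply
    (hX : ∀ (k : ℕ) (ω : Ω), X (k + 1) ω = a (k + 1) * X k ω + u (k + 1) ω) (k : ℕ) :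
    Measurable[pastField (X 0) u k] (X k) := by
  induction k with
  | zero => exact measurable_iff_comap_le.2 le_sup_left
  | succ k ih =>
    have h1 : Measurable[pastField (X 0) u (k + 1)] (X k) :=
      ih.mono (pastField_mono _ k.le_succ) le_rfl
    have h2 : Measurable[pastField (X 0) u (k + 1)] (u (k + 1)) :=
      measurable_pastField (by omega) le_rfl
    rw [show X (k + 1) = fun ω => a (k + 1) * X k ω + u (k + 1) ω from funext (hX k)]
    exact (h1.const_mul _).add h2

theorem le_alphaMix [IsProbabilityMeasure μ] (Y : Ω → ℝ) (n k : ℕ) {A B : Set Ω}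
    (hA : MeasurableSet[pastField Y u k] A) (hB : MeasurableSet[futureField u (k + n)] B) :
    |μ.real (A ∩ B) - μ.real A * μ.real B| ≤ alphaMix μ Y u n := by
  refine le_csSup ⟨1, ?_⟩ ⟨k, A, B, hA, hB, rfl⟩
  rintro x ⟨k, A, B, -, -, rfl⟩
  have h1 : μ.real A * μ.real B ≤ 1 := mul_le_one₀ measureReal_le_one measureReal_nonneg
    measureReal_le_one
  have h2 : 0 ≤ μ.real A * μ.real B := mul_nonneg measureReal_nonneg measureReal_nonneg
  have h3 : μ.real (A ∩ B) ≤ 1 := measureReal_le_one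
  have h4 : 0 ≤ μ.real (A ∩ B) := measureReal_nonneg
  exact abs_le.2 ⟨by linarith, by linarith⟩

/-- The part of `blockSum` that involves only the innovations after time `⌊n/2⌋ P`. -/
noncomputable def recentSum (a : ℕ → ℝ) (u : ℕ → Ω → ℝ) (P n : ℕ) (ω : Ω) : ℝ :=
  ∑ j ∈ Finset.Ico (n / 2) n, (parPhi a P ^ (n - j))⁻¹ * parU a u P j P ω

/-- The older half is itself a weighted sum of the same kind, discounted by a further power of `φ`.
-/
theorem blockSum_eq_add_recentSum (n : ℕ) (ω : Ω) : blockSum a u P n ω =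
    (parPhi a P ^ (n - n / 2))⁻¹ * blockSum a u P (n / 2) ω + recentSum a u P n ω := by
  have h : n / 2 ≤ n := Nat.div_le_self n 2
  rw [blockSum, geomConv, ← Finset.sum_range_add_sum_Ico _ h, blockSum, geomConv, Finset.mul_sum,
    recentSum]
  congr 1
  refine Finset.sum_congr rfl fun j hj => ?_
  have := Finset.mem_range.1 hj
  rw [← mul_assoc, ← mul_inv, ← pow_add]
  congr 3
  omega

theorem measurable_recentSum (n : ℕ) :
    Measurable[futureField u (n / 2 * P)] (recentSum a u P n) := by
  refine Finset.measurable_fun_sum _ fun j hj => Measurable.const_mul ?_ _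
  refine Finset.measurable_fun_sum _ fun s hs => Measurable.const_mul ?_ _
  have h1 := (Finset.mem_Icc.1 hs).1
  have h2 := Nat.mul_le_mul_right P (Finset.mem_Ico.1 hj).1
  exact measurable_futureField (by omega) (by omega)

/-- Under strong mixing the distant past and the recent innovations are asymptotically
independent. -/
theorem StrongMixing.tendsto_integral_exp [IsProbabilityMeasure μ] (hP : 0 < P)
    (hM : StrongMixing μ (X 0) u) (hX0 : Measurable (X 0)) (hu : ∀ k, 1 ≤ k → Measurable (u k))
    {f g : ℕ → Ω → ℝ} (hf : ∀ n, Measurable[pastField (X 0) u (n / 4 * P)] (f n))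
    (hg : ∀ n, Measurable[futureField u (n / 2 * P)] (g n)) (s t : ℝ) :
    Tendsto (fun n =>
      ∫ ω, Complex.exp ((s * f n ω + t * g n ω : ℝ) * Complex.I) ∂μ -
        (∫ ω, Complex.exp ((s * f n ω : ℝ) * Complex.I) ∂μ) *
          ∫ ω, Complex.exp ((t * g n ω : ℝ) * Complex.I) ∂μ) atTop (𝓝 0) := by
  -- Past until `⌊n/4⌋ P`, future from `⌊n/2⌋ P`: the gap diverges, so the mixing coefficient at the
  -- gap tends to `0`.
  have hgap : Tendsto (fun n : ℕ => n / 2 * P - n / 4 * P) atTop atTop := by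
    refine tendsto_atTop.2 fun b => ?_
    filter_upwards [eventually_ge_atTop (4 * b + 4)] with n hn
    rw [← Nat.sub_mul]
    exact le_trans (by omega) (Nat.le_mul_of_pos_right _ hP)
  have h := (hM.comp hgap).const_mul 16
  rw [mul_zero] at h
  refine squeeze_zero_norm (fun n => ?_) h
  have hle : n / 4 * P ≤ n / 2 * P := Nat.mul_le_mul_right P (by omega)
  refine norm_integral_exp_add_sub_le (pastField_le hX0 hu (n / 4 * P))
    (futureField_le hu (n / 2 * P)) (fun A B hA hB => ?_) ((hf n).const_mul s) ((hg n).const_mul t)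
  refine le_alphaMix (X 0) (n / 2 * P - n / 4 * P) (n / 4 * P) hA ?_
  rwa [Nat.add_sub_cancel' hle]

end Fields

/-! ### Time reversal, joint convergence and the limit law -/

section Limit

variable {Ω : Type*} {m₀ : MeasurableSpace Ω} {μ : Measure Ω} [IsProbabilityMeasure μ]
  {a : ℕ → ℝ} {u X ustar : ℕ → Ω → ℝ} {P : ℕ}

theorem measurable_parU (hu : ∀ k, 1 ≤ k → Measurable (u k)) (n r : ℕ) :
    Measurable (parU a u P n r) :=
  Finset.measurable_fun_sum _ fun s hs =>
    (hu _ (by have := (Finset.mem_Icc.1 hs).1; omega)).const_mul _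

theorem measurable_geomConv {q : ℝ} {x : ℕ → Ω → ℝ} {n : ℕ} (hx : ∀ j, Measurable (x j)) :
    Measurable fun ω => geomConv q (fun j => x j ω) n :=
  Finset.measurable_fun_sum _ fun j _ => (hx j).const_mul _

theorem measurable_blockSum (hu : ∀ k, 1 ≤ k → Measurable (u k)) (n : ℕ) :
    Measurable (blockSum a u P n) :=
  measurable_geomConv fun j => measurable_parU hu j P

theorem measurable_parZeta (hu : ∀ k, 1 ≤ k → Measurable (u k)) : Measurable (parZeta a u P) := by
  have h : ∀ n, StronglyMeasurable (parZ a u P n) := fun n =>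
    (Finset.measurable_fun_sum _ fun l _ =>
      (measurable_parU hu l P).const_mul _).stronglyMeasurable
  exact (StronglyMeasurable.limUnder (l := atTop) h).measurable

theorem measurable_zetaStar (hu : ∀ k, Measurable (ustar k)) (r : ℕ) :
    Measurable (zetaStar a ustar P r) :=
  Measurable.tsum fun _ => (hu _).const_mul _

omit [IsProbabilityMeasure μ] in
-- Both vectors are measurable functionals of the two independent inputs, obtained by evaluating the
-- same definitions on coordinate processes.
theorem indepFun_zetaStar
    (h : IndepFun (fun ω (k : ℕ) => ustar k ω) (fun ω => (X 0 ω, fun k : ℕ => u (k + 1) ω)) μ) :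
    IndepFun (fun ω (r : Finset.Icc 1 P) => zetaStar a ustar P r ω)
      (fun ω => (X 0 ω, parZeta a u P ω)) μ := by
  have h1 : Measurable fun (v : ℕ → ℝ) (r : Finset.Icc 1 P) =>
      zetaStar a (fun k (v : ℕ → ℝ) => v k) P r v :=
    measurable_pi_lambda _ fun r => measurable_zetaStar (fun k => measurable_pi_apply k) r
  have h2 : Measurable fun p : ℝ × (ℕ → ℝ) =>
      (p.1, parZeta a (fun k (v : ℕ → ℝ) => v (k - 1)) P p.2) :=
    measurable_fst.prodMk
      ((measurable_parZeta fun k _ => measurable_pi_apply (k - 1)).comp measurable_snd)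
  -- The input sequence starts at `u_1`, hence the shift `k - 1`; it is harmless because only
  -- indices `lP + s ≥ 1` occur.
  have e : ∀ ω, parZeta a (fun k (v : ℕ → ℝ) => v (k - 1)) P (fun k => u (k + 1) ω) =
      parZeta a u P ω := fun ω => by
    rw [parZeta, parZeta]
    congr 1
    ext n
    refine Finset.sum_congr rfl fun l _ => ?_
    congr 1
    refine Finset.sum_congr rfl fun s hs => ?_
    have h1 : l * P + s - 1 + 1 = l * P + s :=
      Nat.sub_add_cancel (by have := (Finset.mem_Icc.1 hs).1; omega)
    simp only [h1]
  have := h.comp h1 h2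
  simpa only [Function.comp_def, e] using! this

/-- The weighted sum of the `ζ_r^*` truncated after `n` terms. -/
noncomputable def starSum (a : ℕ → ℝ) (ustar : ℕ → Ω → ℝ) (P n : ℕ) (ω : Ω) : ℝ :=
  ∑ r ∈ Finset.Icc 1 P, coeffProd a (r + 1) P *
    ∑ j ∈ Finset.range n, starTerm a ustar P r (j + 1) ω

omit m₀ in
theorem seasonSum_eq_sum {r : ℕ} (hr : r ≤ P) (n : ℕ) (ω : Ω) : seasonSum a u P r n ω =
    ∑ j ∈ Finset.range n, (parPhi a P ^ (j + 1))⁻¹ * u (n * P - ((j + 1) * P - r)) ω := by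
  rw [seasonSum, geomConv, ← Finset.sum_range_reflect]
  refine Finset.sum_congr rfl fun j hj => ?_
  have hj' := Finset.mem_range.1 hj
  obtain ⟨k, rfl⟩ : ∃ k, n = k + (j + 1) := ⟨n - (j + 1), by omega⟩
  have e1 : k + (j + 1) - 1 - j = k := by omega
  have e2 : k + (j + 1) - k = j + 1 := by omega
  have e3 : (k + (j + 1)) * P - ((j + 1) * P - r) = k * P + r := by
    have h1 : (k + (j + 1)) * P = k * P + (j + 1) * P := add_mul _ _ _
    have h2 : P ≤ (j + 1) * P := Nat.le_mul_of_pos_left _ (by omega)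
    omega
  rw [e1, e2, e3]

omit [IsProbabilityMeasure μ] in
-- Time reversal: both sums are the same functional `G` of a vector of length `nP`, the starred one
-- read forwards and the innovations backwards from `u_{nP}`.
theorem identDistrib_blockSum_starSum {n : ℕ}
    (h : IdentDistrib (fun ω (i : Fin (n * P)) => ustar i ω)
      (fun ω (i : Fin (n * P)) => u (n * P - i) ω) μ μ) :
    IdentDistrib (starSum a ustar P n) (blockSum a u P n) μ μ := by
  -- The default `0` is never reached: `r ≥ 1` and `j < n` give `(j+1)P - r < nP`.
  set G : (Fin (n * P) → ℝ) → ℝ := fun v => ∑ r ∈ Finset.Icc 1 P, coeffProd a (r + 1) P *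
    ∑ j ∈ Finset.range n, (parPhi a P ^ (j + 1))⁻¹ *
      if hi : (j + 1) * P - r < n * P then v ⟨(j + 1) * P - r, hi⟩ else 0 with hG
  have hGm : Measurable G := by
    refine Finset.measurable_fun_sum _ fun r _ => Measurable.const_mul ?_ _
    refine Finset.measurable_fun_sum _ fun j _ => Measurable.const_mul ?_ _
    split_ifs
    · exact measurable_pi_apply _
    · exact measurable_const
  have hlt : ∀ r ∈ Finset.Icc 1 P, ∀ j ∈ Finset.range n, (j + 1) * P - r < n * P := by
    intro r hr j hj
    obtain ⟨h1, h2⟩ := Finset.mem_Icc.1 hr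
    have h3 : (j + 1) * P ≤ n * P := Nat.mul_le_mul_right P (Finset.mem_range.1 hj)
    have h4 : P ≤ (j + 1) * P := Nat.le_mul_of_pos_left _ (by omega)
    omega
  have := h.comp hGm
  convert! this using 1
  · ext ω
    refine Finset.sum_congr rfl fun r hr => ?_
    congr 1
    refine Finset.sum_congr rfl fun j hj => ?_
    rw [dif_pos (hlt r hr j hj), starTerm]
  · ext ω
    rw [blockSum_eq_sum]
    refine Finset.sum_congr rfl fun r hr => ?_
    rw [seasonSum_eq_sum (Finset.mem_Icc.1 hr).2]
    congr 1
    refine Finset.sum_congr rfl fun j hj => ?_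
    rw [dif_pos (hlt r hr j hj)]

omit [IsProbabilityMeasure μ] in
theorem integrable_star (hP : 0 < P) (hu : ∀ k, 1 ≤ k → Integrable (u k) μ)
    (h : ∀ n, 1 < n → IdentDistrib (fun ω (i : Fin (n * P)) => ustar i ω)
      (fun ω (i : Fin (n * P)) => u (n * P - i) ω) μ μ) {C : ℝ}
    (hC : ∀ k, 1 ≤ k → ∫ ω, |u k ω| ∂μ ≤ C) (k : ℕ) :
    Integrable (ustar k) μ ∧ ∫ ω, |ustar k ω| ∂μ ≤ C := by
  -- `k + 2` periods contain the coordinate `k` and satisfy the requirement of more than one period.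
  have hk : k < (k + 2) * P := lt_of_lt_of_le (by omega) (Nat.le_mul_of_pos_right _ hP)
  have h1 := (h (k + 2) (by omega)).comp (measurable_pi_apply (⟨k, hk⟩ : Fin ((k + 2) * P)))
  have h1' : IdentDistrib (ustar k) (u ((k + 2) * P - k)) μ μ := h1
  have h2 := h1'.comp (u := fun x : ℝ => |x|) (by fun_prop)
  refine ⟨h1'.integrable_iff.2 (hu _ (by omega)), ?_⟩
  exact h2.integral_eq.trans_le (hC _ (by omega))

/-- The weighted sum of the innovations converges in distribution. -/
theorem tendstoInDistribution_blockSum (hu : ∀ k, 1 ≤ k → Measurable (u k))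
    (hustar : ∀ k, Measurable (ustar k))
    (hs : ∀ᵐ ω ∂μ, ∀ r ∈ Finset.Icc 1 P, Summable fun j : ℕ => starTerm a ustar P r (j + 1) ω)
    (h : ∀ n, 1 < n → IdentDistrib (fun ω (i : Fin (n * P)) => ustar i ω)
      (fun ω (i : Fin (n * P)) => u (n * P - i) ω) μ μ) :
    TendstoInDistribution (blockSum a u P) atTop
      (fun ω => ∑ r ∈ Finset.Icc 1 P, coeffProd a (r + 1) P * zetaStar a ustar P r ω)
      (fun _ => μ) μ := by
  have hW : ∀ n, AEMeasurable (blockSum a u P n) μ := fun n =>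
    (measurable_blockSum hu n).aemeasurable
  have hst : ∀ n, AEMeasurable (starSum a ustar P n) μ := fun n =>
    (Finset.measurable_fun_sum _ fun r _ => Measurable.const_mul (Finset.measurable_fun_sum _
      fun j _ => (hustar _).const_mul _) _).aemeasurable
  have hlim : AEMeasurable (fun ω =>
      ∑ r ∈ Finset.Icc 1 P, coeffProd a (r + 1) P * zetaStar a ustar P r ω) μ :=
    (Finset.measurable_fun_sum _ fun r _ =>
      (measurable_zetaStar hustar r).const_mul _).aemeasurable
  have h1 : TendstoInDistribution (starSum a ustar P) atTop
      (fun ω => ∑ r ∈ Finset.Icc 1 P, coeffProd a (r + 1) P * zetaStar a ustar P r ω)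
      (fun _ => μ) μ := by
    refine tendstoInDistribution_of_ae_tendsto hst hlim ?_
    filter_upwards [hs] with ω hω
    exact tendsto_finsetSum _ fun r hr => ((hω r hr).hasSum.tendsto_sum_nat).const_mul _
  refine ⟨hW, hlim, h1.tendsto.congr' ?_⟩
  filter_upwards [eventually_gt_atTop 1] with n hn
  exact Subtype.ext (identDistrib_blockSum_starSum (h n hn)).map_eq

/-- The difference is an `L¹`-bounded sequence times `φ^{-(n - ⌊n/2⌋)}`; its ratio to `1 +
|blockSum|` at `⌊n/2⌋` is bounded deterministically by that power. -/
theorem tendstoInMeasure_blockSum_sub_recentSum (hphi : 1 < |parPhi a P|)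
    (hum : ∀ k, 1 ≤ k → Measurable (u k)) (hu : ∀ k, 1 ≤ k → Integrable (u k) μ) {C : ℝ}
    (hC : ∀ k, 1 ≤ k → ∫ ω, |u k ω| ∂μ ≤ C) :
    TendstoInMeasure μ (blockSum a u P - recentSum a u P) atTop 0 := by
  have hmeas : ∀ n, Measurable (blockSum a u P n) := fun n =>
    measurable_blockSum hum n
  have hmeas' : ∀ n, Measurable (recentSum a u P n) := fun n =>
    (measurable_recentSum n).mono (futureField_le hum _) le_rfl
  have hint : ∀ n, Integrable (blockSum a u P n) μ := fun n =>
    integrable_geomConv (fun j => integrable_parU hu j P) n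
  refine tendstoInMeasure_zero_of_div (S := fun n ω => |blockSum a u P (n / 2) ω|)
    (fun n => (hmeas n).sub (hmeas' n)) (fun n => (hmeas _).abs) (fun n ω => abs_nonneg _)
    (fun n => (hint _).abs) (fun n => integral_abs_geomConv_le hphi
      (fun j => integrable_parU hu j P) (fun j => integral_abs_parU_le hu hC j P) (n / 2))
    (ae_of_all _ fun ω => ?_)
  have hexp : Tendsto (fun n : ℕ => n - n / 2) atTop atTop := by
    refine tendsto_atTop.2 fun b => ?_
    filter_upwards [eventually_ge_atTop (2 * b)] with n hn
    omega
  have hp : Tendsto (fun n : ℕ => (|parPhi a P| ^ (n - n / 2))⁻¹) atTop (𝓝 0) :=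
    ((tendsto_pow_atTop_atTop_of_one_lt hphi).comp hexp).inv_tendsto_atTop
  refine squeeze_zero_norm (fun n => ?_) hp
  have h0 : 0 < 1 + |blockSum a u P (n / 2) ω| := by positivity
  rw [Pi.sub_apply, Pi.sub_apply, blockSum_eq_add_recentSum, add_sub_cancel_right, norm_div,
    norm_mul, norm_inv, norm_pow, Real.norm_eq_abs, Real.norm_eq_abs, Real.norm_of_nonneg h0.le,
    div_le_iff₀ h0]
  gcongr
  linarith

/-- Joint convergence in distribution of `(φ² - 1) / (X₀ + ζ)` and the weighted innovations. -/
theorem tendstoInDistribution_prodMk_blockSum (hP : 0 < P)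
    (ha : ∀ k, 1 ≤ k → a (k + P) = a k) (hphi : 1 < |parPhi a P|)
    (hX0 : Measurable (X 0))
    (hX : ∀ (k : ℕ) (ω : Ω), X (k + 1) ω = a (k + 1) * X k ω + u (k + 1) ω)
    (hum : ∀ k, 1 ≤ k → Measurable (u k)) (hu : ∀ k, 1 ≤ k → Integrable (u k) μ) {C : ℝ}
    (hC : ∀ k, 1 ≤ k → ∫ ω, |u k ω| ∂μ ≤ C)
    (hY : ∀ᵐ ω ∂μ, X 0 ω + parZeta a u P ω ≠ 0) (hM : StrongMixing μ (X 0) u) {W : Ω → ℝ}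
    (hW : TendstoInDistribution (blockSum a u P) atTop W (fun _ => μ) μ) (c : ℝ)
    (hind : IndepFun (fun ω => c / (X 0 ω + parZeta a u P ω)) W μ) :
    TendstoInDistribution (fun n ω => (c / (X 0 ω + parZeta a u P ω), blockSum a u P n ω)) atTop
      (fun ω => (c / (X 0 ω + parZeta a u P ω), W ω)) (fun _ => μ) μ := by
  have hq0 : parPhi a P ≠ 0 := abs_pos.1 (by linarith)
  set H : Ω → ℝ := fun ω => c / (X 0 ω + parZeta a u P ω) with hH
  -- A proxy for `H` determined by the past up to `⌊n/4⌋ P`; `H` itself depends on all innovations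
  -- through `ζ`, so mixing cannot be applied to it directly.
  set f : ℕ → Ω → ℝ := fun n ω => c / ((parPhi a P ^ (n / 4))⁻¹ * X (n / 4 * P) ω) with hf
  have hHm : Measurable H := measurable_const.div (hX0.add (measurable_parZeta hum))
  have hfp : ∀ n, Measurable[pastField (X 0) u (n / 4 * P)] (f n) := fun n =>
    Measurable.const_div ((measurable_pastField_apply hX (n / 4 * P)).const_mul _) c
  have hfm : ∀ n, Measurable (f n) := fun n => (hfp n).mono (pastField_le hX0 hum _) le_rfl
  have hrm : ∀ n, Measurable (recentSum a u P n) := fun n =>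
    (measurable_recentSum n).mono (futureField_le hum _) le_rfl
  have hlim : ∀ᵐ ω ∂μ, Tendsto (fun n => f n ω) atTop (𝓝 (H ω)) := by
    filter_upwards [ae_slowGrowth hphi hu hC, hY] with ω hω hYω
    have h1 := hω.tendsto_inv_pow_mul ha hphi hX (Nat.zero_le P)
    rw [coeffProd_self_succ a 0, one_mul] at h1
    have h4 : Tendsto (fun n : ℕ => n / 4) atTop atTop := Nat.tendsto_div_const_atTop (by norm_num)
    exact (tendsto_const_nhds.div h1 hYω).comp h4
  have hfd : TendstoInDistribution f atTop H (fun _ => μ) μ :=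
    tendstoInDistribution_of_ae_tendsto (fun n => (hfm n).aemeasurable) hHm.aemeasurable hlim
  have hfM : TendstoInMeasure μ f atTop H :=
    tendstoInMeasure_of_tendsto_ae (fun n => (hfm n).aestronglyMeasurable) hlim
  have hBR := tendstoInMeasure_blockSum_sub_recentSum hphi hum hu hC
  have hrd : TendstoInDistribution (recentSum a u P) atTop W (fun _ => μ) μ := by
    refine tendstoInDistribution_of_tendstoInMeasure_sub _ _ hW ?_ fun n => (hrm n).aemeasurable
    rw [tendstoInMeasure_iff_norm] at hBR ⊢
    simpa [norm_sub_rev] using hBR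
  have hjoint := tendstoInDistribution_prodMk_of_asymptotically_independent hfd hrd hind
    (hM.tendsto_integral_exp hP hX0 hum hfp measurable_recentSum)
  -- Slutsky's lemma restores `H` and `blockSum`; the sup norm on the product splits the exceptional
  -- event into one event for each coordinate.
  refine tendstoInDistribution_of_tendstoInMeasure_sub _ _ hjoint ?_ fun n =>
    hHm.aemeasurable.prodMk (hW.forall_aemeasurable n)
  rw [tendstoInMeasure_iff_measureReal_norm] at hfM hBR ⊢
  intro ε hε
  have h0 := (hfM ε hε).add (hBR ε hε)
  rw [add_zero] at h0
  refine squeeze_zero (fun n => measureReal_nonneg) (fun n => ?_) h0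
  refine (measureReal_mono fun ω hω => ?_).trans (measureReal_union_le _ _)
  simp only [Set.mem_ofPred_eq, Pi.sub_apply, Pi.zero_apply, sub_zero, Prod.mk_sub_mk,
    Prod.norm_mk, le_sup_iff] at hω
  simp only [Set.mem_union, Set.mem_ofPred_eq, Pi.sub_apply, Pi.zero_apply, sub_zero]
  rwa [norm_sub_rev (f n ω)]

end Limit

theorem mainTheorem4 {Ω : Type*} [MeasurableSpace Ω] (μ : Measure Ω) [IsProbabilityMeasure μ]
    (P : ℕ) (hP : 0 < P) (a : ℕ → ℝ) (u X : ℕ → Ω → ℝ)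
    -- the coefficients are `P`-periodic and the model is explosive
    (ha : ∀ k : ℕ, 1 ≤ k → a (k + P) = a k)
    (hphi : 1 < |parPhi a P|)
    -- the innovation `u_1, u_2, …` is centered, square integrable, periodically distributed
    (hu_meas : ∀ k : ℕ, 1 ≤ k → Measurable (u k))
    (hu_sq : ∀ k : ℕ, 1 ≤ k → MemLp (u k) 2 μ)
    (hu_cent : ∀ k : ℕ, 1 ≤ k → ∫ ω, u k ω ∂μ = 0)
    (hu_per : ∀ s m : ℕ, 1 ≤ s →
      IdentDistrib (fun ω (i : Fin m) => u (P + s + i) ω) (fun ω (i : Fin m) => u (s + i) ω) μ μ)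
    -- the PAR(1) equation, with square integrable initial value
    (hX0_meas : Measurable (X 0))
    (hX0_sq : MemLp (X 0) 2 μ)
    (hX : ∀ (k : ℕ) (ω : Ω), X (k + 1) ω = a (k + 1) * X k ω + u (k + 1) ω) :
    -- `ζ` is the almost sure limit of `Z_n`
    (∀ᵐ ω ∂μ, Tendsto (fun n : ℕ => parZ a u P n ω) atTop (𝓝 (parZeta a u P ω))) ∧
    -- strong consistency, conditionally on `X_0 + ζ ≠ 0`
    (∀ᵐ ω ∂μ, X 0 ω + parZeta a u P ω ≠ 0 →
      Tendsto (fun n : ℕ => phiTilde X P n ω) atTop (𝓝 (parPhi a P))) ∧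
    -- limit law of the scaled error
    (μ {ω | X 0 ω + parZeta a u P ω = 0} = 0 → StrongMixing μ (X 0) u →
      ∀ ustar : ℕ → Ω → ℝ, (∀ k : ℕ, Measurable (ustar k)) →
        IndepFun (fun ω (k : ℕ) => ustar k ω) (fun ω => (X 0 ω, fun k : ℕ => u (k + 1) ω)) μ →
        (∀ n : ℕ, 1 < n →
          IdentDistrib (fun ω (i : Fin (n * P)) => ustar i ω)
            (fun ω (i : Fin (n * P)) => u (n * P - i) ω) μ μ) →
        (∀ᵐ ω ∂μ, ∀ r ∈ Finset.Icc 1 P,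
          Summable (fun j : ℕ => starTerm a ustar P r (j + 1) ω)) ∧
        IndepFun (fun ω (r : Finset.Icc 1 P) => zetaStar a ustar P r ω)
          (fun ω => (X 0 ω, parZeta a u P ω)) μ ∧
        TendstoInDistribution
          (fun (n : ℕ) ω => parPhi a P ^ n * (phiTilde X P n ω - parPhi a P)) atTop
          (fun ω => (parPhi a P ^ 2 - 1) / (X 0 ω + parZeta a u P ω) *
            ∑ r ∈ Finset.Icc 1 P, coeffProd a (r + 1) P * zetaStar a ustar P r ω)
          (fun _ => μ) μ) := by
  have hui : ∀ k, 1 ≤ k → Integrable (u k) μ := fun k hk => (hu_sq k hk).integrable one_le_two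
  obtain ⟨C, hC⟩ := exists_integral_abs_le hP hu_per
  have hsg := ae_slowGrowth hphi hui hC
  refine ⟨hsg.mono fun ω h => h.tendsto_parZ hphi,
    hsg.mono fun ω h hY => h.tendsto_phiTilde ha hphi hX hY, ?_⟩
  intro hY0 hM ustar hustar_meas hind hlaw
  have hY : ∀ᵐ ω ∂μ, X 0 ω + parZeta a u P ω ≠ 0 := by
    rw [ae_iff]
    simpa using hY0
  have hstar := integrable_star hP hui hlaw hC
  have hsum := ae_summable_starTerm hphi (fun k => (hstar k).1) fun k => (hstar k).2
  have hindz := indepFun_zetaStar (a := a) (P := P) hind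
  refine ⟨hsum, hindz, ?_⟩
  have hW := tendstoInDistribution_blockSum hu_meas hustar_meas hsum hlaw
  have hindW : IndepFun (fun ω => (parPhi a P ^ 2 - 1) / (X 0 ω + parZeta a u P ω))
      (fun ω => ∑ r ∈ Finset.Icc 1 P, coeffProd a (r + 1) P * zetaStar a ustar P r ω) μ := by
    have h1 : Measurable fun p : ℝ × ℝ => (parPhi a P ^ 2 - 1) / (p.1 + p.2) :=
      measurable_const.div (measurable_fst.add measurable_snd)
    have h2 : Measurable fun v : Finset.Icc 1 P → ℝ =>
        ∑ r : Finset.Icc 1 P, coeffProd a (r + 1) P * v r := by fun_prop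
    have h3 := hindz.symm.comp h1 h2
    convert! h3 using 1
    ext ω
    exact (Finset.sum_coe_sort (Finset.Icc 1 P)
      fun r => coeffProd a (r + 1) P * zetaStar a ustar P r ω).symm
  have hjoint := tendstoInDistribution_prodMk_blockSum hP ha hphi hX0_meas hX hu_meas hui hC hY hM
    hW _ hindW
  -- The continuous mapping theorem for multiplication yields the limit law of the leading term;
  -- what remains is its difference from the scaled error.
  have hprod := hjoint.continuous_comp (g := fun p : ℝ × ℝ => p.1 * p.2) (by fun_prop)
  have hXm : ∀ k, Measurable (X k) := fun k =>
    (measurable_pastField_apply hX k).mono (pastField_le hX0_meas hu_meas k) le_rfl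
  have hTm : ∀ n, Measurable fun ω => parPhi a P ^ n * (phiTilde X P n ω - parPhi a P) := by
    intro n
    refine ((Finset.measurable_fun_prod _ fun r _ => ?_).sub_const _).const_mul _
    exact (Finset.measurable_fun_sum _ fun j _ => (hXm _).mul (hXm _)).div
      (Finset.measurable_fun_sum _ fun j _ => (hXm _).pow_const 2)
  have hBm : ∀ n, Measurable (blockSum a u P n) := fun n =>
    measurable_blockSum hu_meas n
  have hHm : Measurable fun ω => (parPhi a P ^ 2 - 1) / (X 0 ω + parZeta a u P ω) :=
    measurable_const.div (hX0_meas.add (measurable_parZeta hu_meas))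
  have hpos : ∀ r ∈ Finset.Icc 1 P, ∀ j, 1 ≤ j * P + r := fun r hr j => by
    have := (Finset.mem_Icc.1 hr).1
    omega
  have hSi : ∀ n, ∀ r ∈ Finset.Icc 1 P, Integrable (fun ω => |seasonSum a u P r n ω|) μ :=
    fun n r hr => (integrable_geomConv (fun j => hui _ (hpos r hr j)) n).abs
  refine tendstoInDistribution_of_tendstoInMeasure_sub _ _ hprod ?_ fun n => (hTm n).aemeasurable
  -- The pathwise estimate `SlowGrowth.tendsto_error_div` controls the remainder relative to `1 +
  -- S`, and the moment bounds on the seasonal sums keep `S` bounded in `L¹`.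
  refine tendstoInMeasure_zero_of_div
    (S := fun n ω => ∑ r ∈ Finset.Icc 1 P, |seasonSum a u P r n ω|)
    (C := ∑ _r ∈ Finset.Icc 1 P, (|parPhi a P| - 1)⁻¹ * C)
    (fun n => (hTm n).sub (hHm.mul (hBm n)))
    (fun n => Finset.measurable_fun_sum _ fun r hr => 
      (measurable_geomConv fun j => hu_meas _ (hpos r hr j)).abs)
    (fun n ω => Finset.sum_nonneg fun _ _ => abs_nonneg _)
    (fun n => integrable_finsetSum _ (hSi n)) (fun n => ?_) ?_
  · rw [integral_finsetSum _ (hSi n)]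
    exact Finset.sum_le_sum fun r hr => integral_abs_geomConv_le hphi
      (fun j => hui _ (hpos r hr j)) (fun j => hC _ (hpos r hr j)) n
  · filter_upwards [hsg, hY] with ω hω hYω
    exact hω.tendsto_error_div ha hphi hX hYω
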